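/- Let $m,n,d\ge 1$, let $\mathbf\Sigma\in\mathbb R^{m\times n}$ have rank $d$ with singular values $\sigma_1\ge\dots\ge\sigma_d>0$, let $\kappa=\sigma_1/\sigma_d$, and let $$f(\mathbf U,\mathbf V)=\tfrac12\|\mathbf U\mathbf V^\top-\mathbf\Sigma\|_F^2,\qquad \mathbf U\in\mathbb R^{m\times d},\ \mathbf V\in\mathbb R^{n\times d}.$$ Gradient descent with constant step size $\eta>0$ is $$\mathbf U_{t+1}=\mathbf U_t+\eta(\mathbf\Sigma-\mathbf U_t\mathbf V_t^\top)\mathbf V_t,\qquad \mathbf V_{t+1}=\mathbf V_t+\eta(\mathbf\Sigma-\mathbf U_t\mathbf V_t^\top)^\top\mathbf U_t .$$ There are universal constants $k\in\mathbb N$ and $C>0$, and for every failure probability $\rho\in(0,1)$ there are constants $c_1,c_2>0$ depending only on $\rho$, such that the following holds for all such $m,n,d,\mathbf\Sigma$. Let $$0<\varepsilon\le \frac{c_1}{\ln^k((m+n)\kappa)}\cdot\frac{\sigma_d}{\sqrt{d^3\sigma_1}\,(m+n)},$$ and let all entries of $\mathbf U_0$ and $\mathbf V_0$ be independent $N(0,\varepsilon^2)$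 random variables. Then there is $T_{\rm total}(\delta,\eta)$, not depending on the realization of the initialization, such that for every $\delta>0$ and every step size $0<\eta\le c_2\,\frac{\sigma_d\varepsilon^2}{d\sigma_1^3}$: 1. $T_{\rm total}(\delta,\eta)\le C\Big(\frac1{\eta\sigma_d}\ln\frac{d\sigma_d}{\varepsilon^2}+\frac1{\eta\sigma_d}\max\{0,\ln\frac{\sigma_d^2}{\delta}\}\Big)$; 2. if moreover $\delta\le\min\{\sigma_d,\sigma_d^2\}$, then also $T_{\rm total}(\delta,\eta)\le C\Big(\frac1{\eta\sigma_d}\ln\frac{d\sigma_d}{\varepsilon}+\frac1{\eta\sigma_d}\ln\frac{\sigma_d}{\delta}\Big)$; 3. with probability at least $1-\rho$ over the initialization, $f(\mathbf U_t,\mathbf V_t)\le\delta$ for all integers $t\ge 0$ with $t>T_{\rm total}(\delta,\eta)$. -/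

import Mathlib

open scoped Matrix

noncomputable section

namespace MatFac

/-- The `i`-th largest singular value of a real matrix, counted from `0`:
`sval S 0` is `σ₁` and, for a matrix of rank `d ≥ 1`, `sval S (d - 1)` is the smallest
(nonzero) singular value `σ_d`. -/
def sval {m n : ℕ} (S : Matrix (Fin m) (Fin n) ℝ) (i : ℕ) : ℝ :=
  (Matrix.toEuclideanLin S).singularValues i

section Objective

open scoped Matrix.Norms.Frobenius

/-- The objective `f(U, V) = ½ ‖U Vᵀ - S‖_F²` (the norm here is the Frobenius norm). -/
def loss {m n d : ℕ} (S : Matrix (Fin m) (Fin n) ℝ)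
    (U : Matrix (Fin m) (Fin d) ℝ) (V : Matrix (Fin n) (Fin d) ℝ) : ℝ :=
  1 / 2 * ‖U * Vᵀ - S‖ ^ 2

end Objective

/-- One step of gradient descent with step size `η` (both factors are updated simultaneously). -/
def gdStep {m n d : ℕ} (S : Matrix (Fin m) (Fin n) ℝ) (η : ℝ)
    (W : Matrix (Fin m) (Fin d) ℝ × Matrix (Fin n) (Fin d) ℝ) :
    Matrix (Fin m) (Fin d) ℝ × Matrix (Fin n) (Fin d) ℝ :=
  (W.1 + η • ((S - W.1 * W.2ᵀ) * W.2), W.2 + η • ((S - W.1 * W.2ᵀ)ᵀ * W.1))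

/-- The iterate `(U_t, V_t)` of gradient descent with constant step size `η`
started from `(U₀, V₀) = W`. -/
def gdIter {m n d : ℕ} (S : Matrix (Fin m) (Fin n) ℝ) (η : ℝ)
    (W : Matrix (Fin m) (Fin d) ℝ × Matrix (Fin n) (Fin d) ℝ) (t : ℕ) :
    Matrix (Fin m) (Fin d) ℝ × Matrix (Fin n) (Fin d) ℝ :=
  (gdStep S η)^[t] W

/-- The law of a pair of arrays of sizes `m × d` and `n × d`, all of whose entries are
independent Gaussians with mean `0` and variance `ε²`. -/
def gaussianInit (m n d : ℕ) (ε : ℝ) :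
    MeasureTheory.Measure ((Fin m → Fin d → ℝ) × (Fin n → Fin d → ℝ)) :=
  (MeasureTheory.Measure.pi fun _ : Fin m => MeasureTheory.Measure.pi fun _ : Fin d =>
      ProbabilityTheory.gaussianReal 0 (Real.toNNReal (ε ^ 2))).prod
    (MeasureTheory.Measure.pi fun _ : Fin n => MeasureTheory.Measure.pi fun _ : Fin d =>
      ProbabilityTheory.gaussianReal 0 (Real.toNNReal (ε ^ 2)))

end MatFac

end

/-! Let `S = Φ diag(σ) Ψᵀ`. In singular coordinates the half sum `(ΦᵀU + ΨᵀV) / 2` of the factors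
grows like a power iteration, its least singular value gaining a factor `1 + η σ_d / 4` per step
until it reaches `√σ_d / 4`. The half difference `(ΦᵀU - ΨᵀV) / 2` and the components of `U` and `V`
outside the singular spaces stay of the size of the initialization, since to first order in `η` they
contract, up to a multiple of the imbalance `UᵀU - VᵀV`, which is itself conserved to that order.
From then on the gradient dominates the residual up to the product of the two components outside
the singular spaces. That product decays as well, so a multiple of it added to the loss gives a
Lyapunov function that decreases linearly.

For a Gaussian initialization the norm is controlled by Markov's inequality. The half sum can only
be badly conditioned if one of its columns is close to the span of the others, which confines a
column of the initialization to a thin slab. -/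

noncomputable section

namespace MatFac

open MeasureTheory ProbabilityTheory
open scoped Matrix.Norms.Frobenius InnerProductSpace NNReal

section Frobenius

variable {p q r ι : Type*} [Fintype p] [Fintype q] [Fintype r] [Fintype ι]

lemma frobenius_norm_sq_eq_sum (X : Matrix p q ℝ) : ‖X‖ ^ 2 = ∑ i, ∑ j, X i j ^ 2 := by
  rw [Matrix.frobenius_norm_def, ← Real.sqrt_eq_rpow]
  simp only [Real.rpow_two, Real.norm_eq_abs, sq_abs]
  exact Real.sq_sqrt (by positivity)

lemma frobenius_norm_sq_eq_sum_col (X : Matrix p q ℝ) :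
    ‖X‖ ^ 2 = ∑ j, ‖X.submatrix id fun _ : Unit => j‖ ^ 2 := by
  simp only [frobenius_norm_sq_eq_sum, Finset.univ_unique, Finset.sum_singleton,
    Matrix.submatrix_apply, id_eq]
  exact Finset.sum_comm

/-- The Frobenius inner product `⟪X, Y⟫ = tr (Xᵀ Y)` on real matrices, whose norm is the Frobenius
norm. It is scoped because Mathlib puts no default norm on matrices. -/
scoped instance frobeniusInnerProductSpace : InnerProductSpace ℝ (Matrix p q ℝ) where
  inner X Y := (Xᵀ * Y).trace
  norm_sq_eq_re_inner X := by
    rw [frobenius_norm_sq_eq_sum, Finset.sum_comm]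
    simp [Matrix.trace, Matrix.mul_apply, sq]
  conj_inner_symm X Y := by
    rw [← Matrix.trace_transpose (Xᵀ * Y), Matrix.transpose_mul, Matrix.transpose_transpose]
    rfl
  add_left X Y Z := by simp only [Matrix.transpose_add, Matrix.add_mul, Matrix.trace_add]
  smul_left X Y c := by simp

lemma inner_eq_trace (X Y : Matrix p q ℝ) : ⟪X, Y⟫_ℝ = (Xᵀ * Y).trace := rfl

lemma inner_mul_left_eq (A : Matrix r p ℝ) (X : Matrix p q ℝ) (Y : Matrix r q ℝ) :
    ⟪A * X, Y⟫_ℝ = ⟪X, Aᵀ * Y⟫_ℝ := by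
  simp only [inner_eq_trace, Matrix.transpose_mul, Matrix.mul_assoc]

lemma inner_mul_right_eq (X : Matrix p q ℝ) (B : Matrix q r ℝ) (Y : Matrix p r ℝ) :
    ⟪X * B, Y⟫_ℝ = ⟪X, Y * Bᵀ⟫_ℝ := by
  rw [inner_eq_trace, inner_eq_trace, Matrix.transpose_mul, Matrix.mul_assoc, Matrix.trace_mul_comm,
    Matrix.mul_assoc]

lemma norm_transpose_mul_self_le (X : Matrix p q ℝ) : ‖Xᵀ * X‖ ≤ ‖X‖ ^ 2 := by
  simpa only [Matrix.frobenius_norm_transpose, sq] using Matrix.frobenius_norm_mul Xᵀ X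

lemma norm_mul_transpose_comm (X : Matrix p q ℝ) (Y : Matrix r q ℝ) : ‖X * Yᵀ‖ = ‖Y * Xᵀ‖ := by
  rw [← Matrix.frobenius_norm_transpose, Matrix.transpose_mul, Matrix.transpose_transpose]

lemma norm_mul_transpose_le (X : Matrix p q ℝ) (Y : Matrix r q ℝ) : ‖X * Yᵀ‖ ≤ ‖X‖ * ‖Y‖ := by
  simpa only [Matrix.frobenius_norm_transpose] using Matrix.frobenius_norm_mul X Yᵀ

lemma inner_mul_gram_self (X : Matrix p r ℝ) (V : Matrix q r ℝ) :
    ⟪X, X * (Vᵀ * V)⟫_ℝ = ‖X * Vᵀ‖ ^ 2 := by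
  rw [real_inner_comm, ← Matrix.mul_assoc, inner_mul_right_eq, real_inner_self_eq_norm_sq]

lemma norm_gram_sq_add_norm_gram_sq (U : Matrix p r ℝ) (V : Matrix q r ℝ) :
    ‖Uᵀ * U‖ ^ 2 + ‖Vᵀ * V‖ ^ 2 = ‖Uᵀ * U - Vᵀ * V‖ ^ 2 + 2 * ‖U * Vᵀ‖ ^ 2 := by
  have hinner : ⟪Uᵀ * U, Vᵀ * V⟫_ℝ = ‖U * Vᵀ‖ ^ 2 := by
    rw [inner_mul_left_eq, Matrix.transpose_transpose, inner_mul_gram_self]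
  rw [norm_sub_sq_real, hinner]
  ring

lemma norm_pow_four_le (U : Matrix p q ℝ) :
    (‖U‖ ^ 2) ^ 2 ≤ Fintype.card q * ‖Uᵀ * U‖ ^ 2 := by
  classical
  have hone : ‖(1 : Matrix q q ℝ)‖ ^ 2 = Fintype.card q := by
    rw [← real_inner_self_eq_norm_sq, inner_eq_trace]
    simp
  have htrace : ‖U‖ ^ 2 = ⟪(1 : Matrix q q ℝ), Uᵀ * U⟫_ℝ := by
    rw [← inner_mul_left_eq, Matrix.mul_one, real_inner_self_eq_norm_sq]
  calc (‖U‖ ^ 2) ^ 2 ≤ (‖(1 : Matrix q q ℝ)‖ * ‖Uᵀ * U‖) ^ 2 := by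
        gcongr
        exact htrace.trans_le (real_inner_le_norm _ _)
    _ = Fintype.card q * ‖Uᵀ * U‖ ^ 2 := by rw [mul_pow, hone]

lemma norm_sub_mul_gram_sq_le (J : Matrix p r ℝ) (V : Matrix q r ℝ) {η : ℝ}
    (hη : 0 ≤ η) (hV : η * ‖V‖ ^ 2 ≤ 1) :
    ‖J - η • (J * (Vᵀ * V))‖ ^ 2 ≤ ‖J‖ ^ 2 - η * ‖J * Vᵀ‖ ^ 2 := by
  have hquad : ‖η • (J * (Vᵀ * V))‖ ^ 2 ≤ η * ‖J * Vᵀ‖ ^ 2 := by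
    calc ‖η • (J * (Vᵀ * V))‖ ^ 2 = η ^ 2 * ‖J * Vᵀ * V‖ ^ 2 := by
          rw [norm_smul, mul_pow, Real.norm_of_nonneg hη, Matrix.mul_assoc]
      _ ≤ η ^ 2 * (‖J * Vᵀ‖ * ‖V‖) ^ 2 := by gcongr; exact Matrix.frobenius_norm_mul _ _
      _ = η * ‖J * Vᵀ‖ ^ 2 * (η * ‖V‖ ^ 2) := by ring
      _ ≤ η * ‖J * Vᵀ‖ ^ 2 := mul_le_of_le_one_right (by positivity) hV
  rw [norm_sub_sq_real, real_inner_smul_right, inner_mul_gram_self]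
  linarith

section Diagonal

variable [DecidableEq ι] {σ : ι → ℝ} {c : ℝ}

lemma norm_diagonal_mul_sq (σ : ι → ℝ) (X : Matrix ι q ℝ) :
    ‖Matrix.diagonal σ * X‖ ^ 2 = ∑ i, ∑ j, σ i ^ 2 * X i j ^ 2 := by
  simp only [frobenius_norm_sq_eq_sum, Matrix.diagonal_mul, mul_pow]

lemma norm_diagonal_mul_le (hσ : ∀ i, |σ i| ≤ c) (hc : 0 ≤ c) (X : Matrix ι q ℝ) :
    ‖Matrix.diagonal σ * X‖ ≤ c * ‖X‖ := by
  refine le_of_sq_le_sq ?_ (by positivity)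
  rw [norm_diagonal_mul_sq, mul_pow, frobenius_norm_sq_eq_sum, Finset.mul_sum]
  simp only [Finset.mul_sum]
  gcongr ∑ i, ∑ j, ?_ * _ with i
  exact sq_le_sq' (neg_le_of_abs_le (hσ i)) (le_of_abs_le (hσ i))

lemma mul_norm_sq_le_inner_diagonal_mul (hσ : ∀ i, c ≤ σ i) (X : Matrix ι q ℝ) :
    c * ‖X‖ ^ 2 ≤ ⟪X, Matrix.diagonal σ * X⟫_ℝ := by
  have hinner : ⟪X, Matrix.diagonal σ * X⟫_ℝ = ∑ i, ∑ j, σ i * X i j ^ 2 := by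
    rw [inner_eq_trace, Matrix.trace, Finset.sum_comm]
    refine Finset.sum_congr rfl fun j _ => ?_
    rw [Matrix.diag_apply, Matrix.mul_apply]
    refine Finset.sum_congr rfl fun i _ => ?_
    rw [Matrix.transpose_apply, Matrix.diagonal_mul]
    ring
  rw [hinner, frobenius_norm_sq_eq_sum, Finset.mul_sum]
  simp only [Finset.mul_sum]
  gcongr with i _ j
  exact hσ i

end Diagonal

end Frobenius

section Perp

variable {p q r s ι : Type*} [Fintype p] [Fintype q] [Fintype r] [Fintype ι]

/-- The component of the columns of `U` orthogonal to the columns of `Φ`, when the latter are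
orthonormal. -/
def perp (Φ : Matrix p ι ℝ) (U : Matrix p s ℝ) : Matrix p s ℝ := U - Φ * (Φᵀ * U)

lemma perp_mul (Φ : Matrix p ι ℝ) (U : Matrix p r ℝ) (X : Matrix r s ℝ) :
    perp Φ (U * X) = perp Φ U * X := by
  simp only [perp, Matrix.sub_mul, Matrix.mul_assoc]

lemma perp_add (Φ : Matrix p ι ℝ) (U V : Matrix p s ℝ) :
    perp Φ (U + V) = perp Φ U + perp Φ V := by
  simp only [perp, Matrix.mul_add, add_sub_add_comm]

lemma perp_sub (Φ : Matrix p ι ℝ) (U V : Matrix p s ℝ) :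
    perp Φ (U - V) = perp Φ U - perp Φ V := by
  simp only [perp, Matrix.mul_sub, sub_sub_sub_comm]

lemma perp_smul (Φ : Matrix p ι ℝ) (c : ℝ) (U : Matrix p s ℝ) :
    perp Φ (c • U) = c • perp Φ U := by
  simp only [perp, Matrix.mul_smul, smul_sub]

variable [DecidableEq ι] {Φ : Matrix p ι ℝ}

lemma perp_self (hΦ : Φᵀ * Φ = 1) : perp Φ Φ = 0 := by
  rw [perp, hΦ, Matrix.mul_one, sub_self]

lemma gram_eq_add_gram_perp (hΦ : Φᵀ * Φ = 1) (U : Matrix p s ℝ) :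
    Uᵀ * U = (Φᵀ * U)ᵀ * (Φᵀ * U) + (perp Φ U)ᵀ * perp Φ U := by
  have hproj : Φᵀ * (Φ * (Φᵀ * U)) = Φᵀ * U := by rw [← Matrix.mul_assoc, hΦ, Matrix.one_mul]
  simp only [perp, Matrix.transpose_sub, Matrix.transpose_mul, Matrix.transpose_transpose,
    Matrix.sub_mul, Matrix.mul_sub, Matrix.mul_assoc, hproj]
  abel

lemma norm_sq_eq_add_norm_perp_sq (hΦ : Φᵀ * Φ = 1) (U : Matrix p r ℝ) :
    ‖U‖ ^ 2 = ‖Φᵀ * U‖ ^ 2 + ‖perp Φ U‖ ^ 2 := by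
  simp only [← real_inner_self_eq_norm_sq, inner_eq_trace]
  rw [gram_eq_add_gram_perp hΦ U, Matrix.trace_add]

lemma norm_transpose_mul_le (hΦ : Φᵀ * Φ = 1) (U : Matrix p r ℝ) : ‖Φᵀ * U‖ ≤ ‖U‖ :=
  le_of_sq_le_sq (by linarith [norm_sq_eq_add_norm_perp_sq hΦ U, sq_nonneg ‖perp Φ U‖])
    (norm_nonneg _)

lemma norm_perp_le (hΦ : Φᵀ * Φ = 1) (U : Matrix p r ℝ) : ‖perp Φ U‖ ≤ ‖U‖ :=
  le_of_sq_le_sq (by linarith [norm_sq_eq_add_norm_perp_sq hΦ U, sq_nonneg ‖Φᵀ * U‖])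
    (norm_nonneg _)

lemma norm_mul_eq_of_transpose_mul_self (hΦ : Φᵀ * Φ = 1) (X : Matrix ι r ℝ) : ‖Φ * X‖ = ‖X‖ := by
  refine (sq_eq_sq₀ (norm_nonneg _) (norm_nonneg _)).mp ?_
  rw [norm_sq_eq_add_norm_perp_sq hΦ, perp_mul, perp_self hΦ, Matrix.zero_mul, norm_zero,
    ← Matrix.mul_assoc, hΦ, Matrix.one_mul]
  ring

end Perp

section BoundedBelow

variable {p q r ι : Type*} [Fintype p] [Fintype q] [Fintype r] [Fintype ι]

/-- `BoundedBelow A s` says that `s |x| ≤ |A x|` for all vectors `x`, i.e. that all singular values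
of `A` on its domain are at least `s`. Vectors are encoded as one-column matrices, so that the
Frobenius norm is the only norm in play. -/
def BoundedBelow (A : Matrix p q ℝ) (s : ℝ) : Prop :=
  ∀ x : Matrix q Unit ℝ, s * ‖x‖ ≤ ‖A * x‖

namespace BoundedBelow

variable {A B : Matrix p q ℝ} {s t β : ℝ}

lemma norm_mul_le (h : BoundedBelow A s) (X : Matrix q r ℝ) : s * ‖X‖ ≤ ‖A * X‖ := by
  rcases le_or_gt s 0 with hs | hs
  · exact (mul_nonpos_of_nonpos_of_nonneg hs (norm_nonneg _)).trans (norm_nonneg _)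
  refine le_of_sq_le_sq ?_ (norm_nonneg _)
  rw [mul_pow, frobenius_norm_sq_eq_sum_col, frobenius_norm_sq_eq_sum_col, Finset.mul_sum]
  refine Finset.sum_le_sum fun j _ => ?_
  rw [← mul_pow]
  exact pow_le_pow_left₀ (by positivity) (h (X.submatrix id fun _ => j)) 2

lemma mono (h : BoundedBelow A s) (hts : t ≤ s) : BoundedBelow A t := fun x =>
  (mul_le_mul_of_nonneg_right hts (norm_nonneg x)).trans (h x)

lemma one [DecidableEq q] : BoundedBelow (1 : Matrix q q ℝ) 1 := fun x => by
  rw [one_mul, Matrix.one_mul]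

lemma mul {C : Matrix q r ℝ} (hA : BoundedBelow A s) (hC : BoundedBelow C t) (hs : 0 ≤ s) :
    BoundedBelow (A * C) (s * t) := fun x =>
  calc s * t * ‖x‖ = s * (t * ‖x‖) := mul_assoc _ _ _
    _ ≤ s * ‖C * x‖ := by gcongr; exact hC x
    _ ≤ ‖A * C * x‖ := by rw [Matrix.mul_assoc]; exact hA _

lemma add (h : BoundedBelow A s) (hB : ‖B‖ ≤ β) : BoundedBelow (A + B) (s - β) := fun x => by
  have hBx : ‖B * x‖ ≤ β * ‖x‖ := (Matrix.frobenius_norm_mul B x).trans (by gcongr)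
  have htri : ‖A * x‖ ≤ ‖(A + B) * x‖ + ‖B * x‖ := by
    simpa only [Matrix.add_mul, add_sub_cancel_right] using norm_sub_le ((A + B) * x) (B * x)
  linarith [h x]

lemma sub (h : BoundedBelow A s) (hB : ‖B‖ ≤ β) : BoundedBelow (A - B) (s - β) := by
  rw [sub_eq_add_neg]
  exact h.add (by rwa [norm_neg])

lemma of_inner {A : Matrix q q ℝ} (h : ∀ x : Matrix q Unit ℝ, s * ‖x‖ ^ 2 ≤ ⟪x, A * x⟫_ℝ) :
    BoundedBelow A s := fun x => by
  rcases (norm_nonneg x).eq_or_lt with hx | hx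
  · rw [← hx, mul_zero]
    exact norm_nonneg _
  · refine le_of_mul_le_mul_left ?_ hx
    linarith [h x, real_inner_le_norm x (A * x)]

lemma transpose {A : Matrix q q ℝ} (h : BoundedBelow A s) (hs : 0 < s) :
    BoundedBelow Aᵀ s := by
  classical
  have hdet : IsUnit A.det := by
    refine isUnit_iff_ne_zero.mpr fun hdet => ?_
    obtain ⟨v, hv, hAv⟩ := Matrix.exists_mulVec_eq_zero_iff.mpr hdet
    have hx := h (Matrix.replicateCol Unit v)
    rw [← Matrix.replicateCol_mulVec, hAv, Matrix.replicateCol_zero, norm_zero] at hx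
    have hnorm : ‖Matrix.replicateCol Unit v‖ = 0 :=
      le_antisymm (nonpos_of_mul_nonpos_right hx hs) (norm_nonneg _)
    exact hv (Matrix.replicateCol_injective
      ((norm_eq_zero.mp hnorm).trans Matrix.replicateCol_zero.symm))
  intro x
  have hcancel : A * (A⁻¹ * x) = x := Matrix.mul_nonsing_inv_cancel_left A x hdet
  have hinv : s * ‖A⁻¹ * x‖ ≤ ‖x‖ := by simpa only [hcancel] using h (A⁻¹ * x)
  have hnorm_sq : ‖x‖ ^ 2 ≤ ‖A⁻¹ * x‖ * ‖Aᵀ * x‖ := by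
    calc ‖x‖ ^ 2 = ⟪A⁻¹ * x, Aᵀ * x⟫_ℝ := by
          rw [← inner_mul_left_eq, hcancel, real_inner_self_eq_norm_sq]
      _ ≤ ‖A⁻¹ * x‖ * ‖Aᵀ * x‖ := real_inner_le_norm _ _
  rcases (norm_nonneg x).eq_or_lt with hx | hx
  · rw [← hx, mul_zero]
    exact norm_nonneg _
  · refine le_of_mul_le_mul_left ?_ hx
    calc ‖x‖ * (s * ‖x‖) = s * ‖x‖ ^ 2 := by ring
      _ ≤ s * (‖A⁻¹ * x‖ * ‖Aᵀ * x‖) := by gcongr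
      _ = s * ‖A⁻¹ * x‖ * ‖Aᵀ * x‖ := by ring
      _ ≤ ‖x‖ * ‖Aᵀ * x‖ := by gcongr

lemma mul_norm_gram_mul_sub_sq_le {η : ℝ} (h : BoundedBelow A s) (hs : 0 ≤ s) (hη : 0 ≤ η)
    (hA : 4 * (η * ‖A‖ ^ 2) ≤ 1) (X : Matrix q r ℝ) :
    3 * (η * ‖Aᵀ * (A * X) - s ^ 2 • X‖ ^ 2) ≤ ⟪X, Aᵀ * (A * X) - s ^ 2 • X⟫_ℝ := by
  set Y := Aᵀ * (A * X) - s ^ 2 • X with hY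
  have hinner (Z : Matrix q r ℝ) : ⟪Z, Y⟫_ℝ = ⟪A * Z, A * X⟫_ℝ - s ^ 2 * ⟪Z, X⟫_ℝ := by
    rw [hY, inner_sub_right, real_inner_smul_right, inner_mul_left_eq]
  have hAY : 4 * η ^ 2 * ‖A * Y‖ ^ 2 ≤ η * ‖Y‖ ^ 2 := by
    calc 4 * η ^ 2 * ‖A * Y‖ ^ 2 ≤ 4 * η ^ 2 * (‖A‖ * ‖Y‖) ^ 2 := by
          gcongr
          exact Matrix.frobenius_norm_mul A Y
      _ = 4 * (η * ‖A‖ ^ 2) * (η * ‖Y‖ ^ 2) := by ring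
      _ ≤ η * ‖Y‖ ^ 2 := mul_le_of_le_one_left (by positivity) hA
  have hstep : s ^ 2 * ‖X - (2 * η) • Y‖ ^ 2 ≤ ‖A * (X - (2 * η) • Y)‖ ^ 2 := by
    rw [← mul_pow]
    exact pow_le_pow_left₀ (by positivity) (h.norm_mul_le _) 2
  rw [Matrix.mul_sub, Matrix.mul_smul, norm_sub_sq_real, norm_sub_sq_real, real_inner_smul_right,
    real_inner_smul_right, norm_smul, norm_smul, mul_pow, mul_pow,
    Real.norm_of_nonneg (by positivity), real_inner_comm, real_inner_comm (A * Y)] at hstep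
  have hXX := hinner X
  have hYY := hinner Y
  rw [real_inner_self_eq_norm_sq] at hYY
  rw [real_inner_self_eq_norm_sq, real_inner_self_eq_norm_sq] at hXX
  nlinarith [show 0 ≤ s ^ 2 * (4 * η ^ 2 * ‖Y‖ ^ 2) by positivity]

lemma sub_cubic {η : ℝ} (h : BoundedBelow A s) (hs : 0 ≤ s) (hη : 0 ≤ η)
    (hA : 4 * (η * ‖A‖ ^ 2) ≤ 1) (hηs : 12 * (η * s ^ 2) ≤ 1) :
    BoundedBelow (A - η • (A * (Aᵀ * A))) (s * (1 - 2 * (η * s ^ 2))) := by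
  intro x
  refine le_of_sq_le_sq ?_ (norm_nonneg _)
  set y := Aᵀ * (A * x) - s ^ 2 • x with hy
  have hgram : Aᵀ * (A * x) = y + s ^ 2 • x := by rw [hy, sub_add_cancel]
  have hy_le : 3 * (η * ‖y‖ ^ 2) ≤ ⟪x, y⟫_ℝ := h.mul_norm_gram_mul_sub_sq_le hs hη hA x
  have hinner_nonneg : 0 ≤ ⟪x, y⟫_ℝ := le_trans (by positivity) hy_le
  have hAx : ‖A * x‖ ^ 2 = ⟪x, y⟫_ℝ + s ^ 2 * ‖x‖ ^ 2 := by
    rw [← real_inner_self_eq_norm_sq, inner_mul_left_eq, hgram, inner_add_right,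
      real_inner_smul_right, real_inner_self_eq_norm_sq]
  have hgram_sq : ‖Aᵀ * (A * x)‖ ^ 2 = ‖y‖ ^ 2 + 2 * s ^ 2 * ⟪x, y⟫_ℝ + s ^ 4 * ‖x‖ ^ 2 := by
    rw [hgram, norm_add_sq_real, real_inner_smul_right, real_inner_comm, norm_smul, mul_pow,
      Real.norm_of_nonneg (by positivity)]
    ring
  have hinner : ⟪A * x, A * (Aᵀ * (A * x))⟫_ℝ = ‖Aᵀ * (A * x)‖ ^ 2 := by
    rw [real_inner_comm, inner_mul_left_eq, real_inner_self_eq_norm_sq]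
  have hfactor : (1 - 2 * (η * s ^ 2)) ^ 2 ≤ 1 - 2 * (η * s ^ 2) := by
    nlinarith [show 0 ≤ η * s ^ 2 by positivity]
  calc (s * (1 - 2 * (η * s ^ 2)) * ‖x‖) ^ 2
      = s ^ 2 * ‖x‖ ^ 2 * (1 - 2 * (η * s ^ 2)) ^ 2 := by ring
    _ ≤ s ^ 2 * ‖x‖ ^ 2 * (1 - 2 * (η * s ^ 2)) := by gcongr
    _ ≤ ‖A * x‖ ^ 2 - 2 * (η * ‖Aᵀ * (A * x)‖ ^ 2) := by
        rw [hAx, hgram_sq]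
        linarith [mul_le_mul_of_nonneg_right hηs hinner_nonneg]
    _ ≤ ‖A * x - η • (A * (Aᵀ * (A * x)))‖ ^ 2 := by
        rw [norm_sub_sq_real, real_inner_smul_right, hinner]
        linarith [sq_nonneg ‖η • (A * (Aᵀ * (A * x)))‖]
    _ = ‖(A - η • (A * (Aᵀ * A))) * x‖ ^ 2 := by
        simp only [Matrix.sub_mul, Matrix.smul_mul, Matrix.mul_assoc]

section Growth

variable [DecidableEq ι] {σ : ι → ℝ} {σ₁ σd η α e ν φ : ℝ} {A E F : Matrix ι ι ℝ}

lemma one_add_smul_diagonal (hσ : ∀ i, σd ≤ σ i) (hη : 0 ≤ η) :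
    BoundedBelow (1 + η • Matrix.diagonal σ) (1 + η * σd) := by
  refine of_inner fun x => ?_
  rw [Matrix.add_mul, Matrix.one_mul, Matrix.smul_mul, inner_add_right, real_inner_smul_right,
    real_inner_self_eq_norm_sq]
  linarith [mul_le_mul_of_nonneg_left (mul_norm_sq_le_inner_diagonal_mul hσ x) hη]

lemma norm_growth_remainder_le (hη : 0 ≤ η) (hσ₁ : 0 ≤ σ₁) (hσ : ∀ i, |σ i| ≤ σ₁)
    (hα : ‖A‖ ≤ α) (he : ‖E‖ ≤ e) (hν : ‖Aᵀ * A + E‖ ≤ ν) (hφ : ‖F‖ ≤ φ) (hησ₁ : η * σ₁ ≤ 1) :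
    ‖η ^ 2 • (Matrix.diagonal σ * (A * (Aᵀ * A + E)))
        - (η ^ 2 • (A * (Aᵀ * A) * E) + η • (Matrix.diagonal σ * (η ^ 2 • (A * (Aᵀ * A) * E))))
        + η • F‖
      ≤ η * (2 * η * (α ^ 3 * e) + η * (σ₁ * (α * ν)) + φ) := by
  have hα0 : 0 ≤ α := (norm_nonneg _).trans hα
  set R := η ^ 2 • (A * (Aᵀ * A) * E) with hR
  have hR_le : ‖R‖ ≤ η ^ 2 * (α ^ 3 * e) := by
    rw [hR, norm_smul, Real.norm_of_nonneg (by positivity)]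
    gcongr
    calc ‖A * (Aᵀ * A) * E‖ ≤ ‖A * (Aᵀ * A)‖ * ‖E‖ := Matrix.frobenius_norm_mul _ _
      _ ≤ ‖A‖ * ‖Aᵀ * A‖ * ‖E‖ := by gcongr; exact Matrix.frobenius_norm_mul _ _
      _ ≤ ‖A‖ * ‖A‖ ^ 2 * ‖E‖ := by gcongr; exact norm_transpose_mul_self_le A
      _ ≤ α * α ^ 2 * e := by gcongr
      _ = α ^ 3 * e := by ring
  have hσR_le : ‖η • (Matrix.diagonal σ * R)‖ ≤ η ^ 2 * (α ^ 3 * e) := by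
    rw [norm_smul, Real.norm_of_nonneg hη]
    calc η * ‖Matrix.diagonal σ * R‖ ≤ η * (σ₁ * ‖R‖) := by
          gcongr
          exact norm_diagonal_mul_le hσ hσ₁ R
      _ = η * σ₁ * ‖R‖ := by ring
      _ ≤ ‖R‖ := mul_le_of_le_one_left (norm_nonneg _) hησ₁
      _ ≤ η ^ 2 * (α ^ 3 * e) := hR_le
  have hσA_le : ‖η ^ 2 • (Matrix.diagonal σ * (A * (Aᵀ * A + E)))‖ ≤ η ^ 2 * (σ₁ * (α * ν)) := by
    rw [norm_smul, Real.norm_of_nonneg (by positivity)]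
    gcongr
    refine (norm_diagonal_mul_le hσ hσ₁ _).trans ?_
    gcongr
    exact (Matrix.frobenius_norm_mul _ _).trans (by gcongr)
  have hF_le : ‖η • F‖ ≤ η * φ := by
    rw [norm_smul, Real.norm_of_nonneg hη]
    gcongr
  refine (norm_add_le _ _).trans ?_
  linarith [norm_sub_le (η ^ 2 • (Matrix.diagonal σ * (A * (Aᵀ * A + E))))
    (R + η • (Matrix.diagonal σ * R)), norm_add_le R (η • (Matrix.diagonal σ * R))]

/-- The update is the product `(1 + η diag σ) (A - η A AᵀA) (1 - η E)` up to a small remainder, and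
lower bounds on singular values multiply. -/
lemma growth (hη : 0 < η) (hσd : 0 < σd) (hσ_lower : ∀ i, σd ≤ σ i) (hσ : ∀ i, |σ i| ≤ σ₁)
    (hσ₁ : 0 ≤ σ₁) (hA : BoundedBelow A s) (hs : 0 ≤ s) (hsσ : 16 * s ^ 2 ≤ σd)
    (hα : ‖A‖ ≤ α) (he : ‖E‖ ≤ e) (heσ : 16 * e ≤ σd) (hν : ‖Aᵀ * A + E‖ ≤ ν) (hφ : ‖F‖ ≤ φ)
    (hηα : 4 * (η * α ^ 2) ≤ 1) (hησ : η * σd ≤ 1) (hησ₁ : η * σ₁ ≤ 1)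
    (herr : 2 * η * (α ^ 3 * e) + η * (σ₁ * (α * ν)) + φ ≤ σd * s / 4) :
    BoundedBelow (A + η • (Matrix.diagonal σ * A - A * (Aᵀ * A + E) + F))
      ((1 + η * σd / 4) * s) := by
  have he0 : 0 ≤ e := (norm_nonneg _).trans he
  have hησ0 : 0 < η * σd := by positivity
  have hηs : η * s ^ 2 ≤ η * σd / 16 := by nlinarith
  have hηe : η * e ≤ η * σd / 16 := by nlinarith
  have hcubic : BoundedBelow (A - η • (A * (Aᵀ * A))) (s * (1 - 2 * (η * s ^ 2))) :=
    hA.sub_cubic hs hη.le (le_trans (by gcongr) hηα) (by linarith)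
  have hdamp : BoundedBelow (1 - η • E) (1 - η * e) :=
    one.sub (by rw [norm_smul, Real.norm_of_nonneg hη.le]; gcongr)
  have hfactors := ((one_add_smul_diagonal hσ_lower hη.le).mul hcubic (by positivity)).mul hdamp
    (mul_nonneg (by positivity) (mul_nonneg hs (by linarith)))
  have hgrow := (hfactors.add
    (norm_growth_remainder_le hη.le hσ₁ hσ hα he hν hφ hησ₁)).mono (t := (1 + η * σd / 4) * s) ?_
  · convert hgrow using 1
    simp only [Matrix.mul_add, Matrix.add_mul, Matrix.mul_sub, Matrix.sub_mul, Matrix.mul_smul,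
      Matrix.smul_mul, Matrix.mul_assoc, Matrix.one_mul, Matrix.mul_one]
    module
  · have hprod : 1 + η * σd / 2 ≤ (1 + η * σd) * ((1 - 2 * (η * s ^ 2)) * (1 - η * e)) := by
      have hloss : 1 - 3 * (η * σd) / 16 ≤ (1 - 2 * (η * s ^ 2)) * (1 - η * e) := by
        nlinarith [show 0 ≤ η * s ^ 2 * (η * e) by positivity]
      nlinarith [mul_le_mul_of_nonneg_left hloss (by positivity : 0 ≤ 1 + η * σd)]
    linarith [mul_le_mul_of_nonneg_left hprod hs, mul_le_mul_of_nonneg_left herr hη.le]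

end Growth

end BoundedBelow

end BoundedBelow

section Descent

variable {p q r : Type*} [Fintype p] [Fintype q] [Fintype r] {η L : ℝ}

lemma norm_add_sq_le_two_mul {E : Type*} [SeminormedAddCommGroup E] (a b : E) :
    ‖a + b‖ ^ 2 ≤ 2 * (‖a‖ ^ 2 + ‖b‖ ^ 2) :=
  (pow_le_pow_left₀ (norm_nonneg _) (norm_add_le a b) 2).trans add_sq_le

lemma norm_mul_transpose_sq_le (X : Matrix p r ℝ) (Y : Matrix q r ℝ) :
    ‖X * Yᵀ‖ ^ 2 ≤ ‖X‖ ^ 2 * ‖Y‖ ^ 2 := by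
  rw [← mul_pow]
  exact pow_le_pow_left₀ (norm_nonneg _) (norm_mul_transpose_le X Y) 2

lemma norm_product_increment_sq_le {U X : Matrix p r ℝ} {V Y : Matrix q r ℝ} (hη : 0 ≤ η)
    (hU : ‖U‖ ^ 2 ≤ L) (hV : ‖V‖ ^ 2 ≤ L) (hY : ‖Y‖ ^ 2 ≤ L ^ 3) (hL : η * L ≤ 1 / 8) :
    ‖η • (X * Vᵀ + U * Yᵀ) + η ^ 2 • (X * Yᵀ)‖ ^ 2 ≤ 5 / 8 * (η * (‖X‖ ^ 2 + ‖Y‖ ^ 2)) := by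
  have hL0 : 0 ≤ L := (sq_nonneg _).trans hU
  have hlinear : ‖η • (X * Vᵀ + U * Yᵀ)‖ ^ 2 ≤ 1 / 4 * (η * (‖X‖ ^ 2 + ‖Y‖ ^ 2)) := by
    calc ‖η • (X * Vᵀ + U * Yᵀ)‖ ^ 2 = η ^ 2 * ‖X * Vᵀ + U * Yᵀ‖ ^ 2 := by
          rw [norm_smul, mul_pow, Real.norm_of_nonneg hη]
      _ ≤ η ^ 2 * (2 * (‖X‖ ^ 2 * ‖V‖ ^ 2 + ‖U‖ ^ 2 * ‖Y‖ ^ 2)) := by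
          gcongr
          refine (norm_add_sq_le_two_mul _ _).trans ?_
          gcongr <;> exact norm_mul_transpose_sq_le _ _
      _ ≤ η ^ 2 * (2 * (‖X‖ ^ 2 * L + L * ‖Y‖ ^ 2)) := by gcongr
      _ = 2 * (η * (‖X‖ ^ 2 + ‖Y‖ ^ 2)) * (η * L) := by ring
      _ ≤ 2 * (η * (‖X‖ ^ 2 + ‖Y‖ ^ 2)) * (1 / 8) := by gcongr
      _ = 1 / 4 * (η * (‖X‖ ^ 2 + ‖Y‖ ^ 2)) := by ring
  have hquadratic : ‖η ^ 2 • (X * Yᵀ)‖ ^ 2 ≤ 1 / 512 * (η * ‖X‖ ^ 2) := by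
    calc ‖η ^ 2 • (X * Yᵀ)‖ ^ 2 = η ^ 4 * ‖X * Yᵀ‖ ^ 2 := by
          rw [norm_smul, mul_pow, Real.norm_of_nonneg (by positivity)]
          ring
      _ ≤ η ^ 4 * (‖X‖ ^ 2 * L ^ 3) := by
          gcongr
          exact (norm_mul_transpose_sq_le X Y).trans (by gcongr)
      _ = η * ‖X‖ ^ 2 * (η * L) ^ 3 := by ring
      _ ≤ η * ‖X‖ ^ 2 * (1 / 8) ^ 3 := by gcongr
      _ = 1 / 512 * (η * ‖X‖ ^ 2) := by ring
  have hY_nonneg : 0 ≤ η * ‖Y‖ ^ 2 := by positivity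
  have hX_nonneg : 0 ≤ η * ‖X‖ ^ 2 := by positivity
  refine (norm_add_sq_le_two_mul _ _).trans ?_
  linarith

lemma norm_sub_product_increment_sq_le (P : Matrix p q ℝ) {U : Matrix p r ℝ} {V : Matrix q r ℝ}
    (hη : 0 ≤ η) (hP : ‖P‖ ≤ L) (hU : ‖U‖ ^ 2 ≤ L) (hV : ‖V‖ ^ 2 ≤ L) (hL : η * L ≤ 1 / 8) :
    ‖P - (η • (P * V * Vᵀ + U * (Pᵀ * U)ᵀ) + η ^ 2 • (P * V * (Pᵀ * U)ᵀ))‖ ^ 2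
      ≤ ‖P‖ ^ 2 - η * (‖P * V‖ ^ 2 + ‖Pᵀ * U‖ ^ 2) := by
  have hL0 : 0 ≤ L := (sq_nonneg _).trans hU
  have hY : ‖Pᵀ * U‖ ^ 2 ≤ L ^ 3 := by
    calc ‖Pᵀ * U‖ ^ 2 ≤ (‖Pᵀ‖ * ‖U‖) ^ 2 := by gcongr; exact Matrix.frobenius_norm_mul _ _
      _ = ‖P‖ ^ 2 * ‖U‖ ^ 2 := by rw [Matrix.frobenius_norm_transpose, mul_pow]
      _ ≤ L ^ 2 * L := by gcongr
      _ = L ^ 3 := by ring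
  have hincrement := norm_product_increment_sq_le (X := P * V) hη hU hV hY hL
  have hleft : ⟪P, P * V * Vᵀ⟫_ℝ = ‖P * V‖ ^ 2 := by
    rw [real_inner_comm, inner_mul_right_eq, Matrix.transpose_transpose,
      real_inner_self_eq_norm_sq]
  have hright : ⟪P, U * (Pᵀ * U)ᵀ⟫_ℝ = ‖Pᵀ * U‖ ^ 2 := by
    rw [real_inner_comm, inner_mul_left_eq, Matrix.transpose_mul, Matrix.transpose_transpose,
      real_inner_self_eq_norm_sq, ← Matrix.frobenius_norm_transpose, Matrix.transpose_mul,
      Matrix.transpose_transpose]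
  have hcross : -(η * (‖P * V‖ ^ 2 + ‖Pᵀ * U‖ ^ 2)) / 8
      ≤ 2 * η ^ 2 * ⟪P, P * V * (Pᵀ * U)ᵀ⟫_ℝ := by
    have hcs : |⟪P, P * V * (Pᵀ * U)ᵀ⟫_ℝ| ≤ L * (‖P * V‖ * ‖Pᵀ * U‖) :=
      (abs_real_inner_le_norm _ _).trans (by gcongr; exact norm_mul_transpose_le _ _)
    have hbound : 2 * η ^ 2 * |⟪P, P * V * (Pᵀ * U)ᵀ⟫_ℝ|
        ≤ η * (‖P * V‖ ^ 2 + ‖Pᵀ * U‖ ^ 2) * (1 / 8) := by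
      calc 2 * η ^ 2 * |⟪P, P * V * (Pᵀ * U)ᵀ⟫_ℝ|
          ≤ 2 * η ^ 2 * (L * (‖P * V‖ * ‖Pᵀ * U‖)) := by gcongr
        _ = η * (2 * ‖P * V‖ * ‖Pᵀ * U‖) * (η * L) := by ring
        _ ≤ η * (‖P * V‖ ^ 2 + ‖Pᵀ * U‖ ^ 2) * (1 / 8) := by
            gcongr
            exact two_mul_le_add_sq _ _
    nlinarith [neg_abs_le ⟪P, P * V * (Pᵀ * U)ᵀ⟫_ℝ, sq_nonneg η]
  rw [norm_sub_sq_real, inner_add_right, real_inner_smul_right, real_inner_smul_right,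
    inner_add_right, hleft, hright]
  have hgrad_nonneg : 0 ≤ η * (‖P * V‖ ^ 2 + ‖Pᵀ * U‖ ^ 2) := by positivity
  linarith

end Descent

section GradientStep

variable {m n d : ℕ}

/-- Pairs `(U, V)` of factors, in the form in which `gdStep` acts on them. -/
abbrev Factors (m n d : ℕ) := Matrix (Fin m) (Fin d) ℝ × Matrix (Fin n) (Fin d) ℝ

/-- The residual `S - U Vᵀ`. -/
def residual (S : Matrix (Fin m) (Fin n) ℝ) (W : Factors m n d) : Matrix (Fin m) (Fin n) ℝ :=
  S - W.1 * W.2ᵀ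

/-- The squared norm of the gradient of `loss S` at `W`. -/
def gradSq (S : Matrix (Fin m) (Fin n) ℝ) (W : Factors m n d) : ℝ :=
  ‖residual S W * W.2‖ ^ 2 + ‖(residual S W)ᵀ * W.1‖ ^ 2

/-- The imbalance `UᵀU - VᵀV` of the two factors, a conserved quantity of gradient flow. -/
def imbalance (W : Factors m n d) : Matrix (Fin d) (Fin d) ℝ := W.1ᵀ * W.1 - W.2ᵀ * W.2

variable (S : Matrix (Fin m) (Fin n) ℝ) {η L : ℝ} {W : Factors m n d}

lemma gradSq_nonneg (W : Factors m n d) : 0 ≤ gradSq S W := by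
  unfold gradSq
  positivity

lemma loss_eq_residual (W : Factors m n d) : loss S W.1 W.2 = 1 / 2 * ‖residual S W‖ ^ 2 := by
  rw [loss, residual, norm_sub_rev]

lemma gdIter_succ (η : ℝ) (W : Factors m n d) (t : ℕ) :
    gdIter S η W (t + 1) = gdStep S η (gdIter S η W t) :=
  Function.iterate_succ_apply' _ _ _

lemma gdStep_eq (η : ℝ) (W : Factors m n d) :
    gdStep S η W = (W.1 + η • (residual S W * W.2), W.2 + η • ((residual S W)ᵀ * W.1)) := rfl

lemma gdStep_snd (η : ℝ) (W : Factors m n d) :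
    (gdStep S η W).2 = W.2 + η • ((Sᵀ - W.2 * W.1ᵀ) * W.1) := by
  simp only [gdStep, Matrix.transpose_sub, Matrix.transpose_mul, Matrix.transpose_transpose]

lemma residual_gdStep (η : ℝ) (W : Factors m n d) :
    residual S (gdStep S η W) = residual S W
      - (η • (residual S W * W.2 * W.2ᵀ + W.1 * ((residual S W)ᵀ * W.1)ᵀ)
        + η ^ 2 • (residual S W * W.2 * ((residual S W)ᵀ * W.1)ᵀ)) := by
  rw [gdStep_eq, residual]
  generalize (residual S W)ᵀ * W.1 = Y
  generalize residual S W * W.2 = X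
  simp only [residual, Matrix.transpose_add, Matrix.transpose_smul, Matrix.add_mul,
    Matrix.mul_add, Matrix.smul_mul, Matrix.mul_smul, smul_add, smul_smul, sq]
  abel

lemma norm_residual_gdStep_sq_le (hη : 0 ≤ η) (hP : ‖residual S W‖ ≤ L) (hU : ‖W.1‖ ^ 2 ≤ L)
    (hV : ‖W.2‖ ^ 2 ≤ L) (hL : η * L ≤ 1 / 8) :
    ‖residual S (gdStep S η W)‖ ^ 2 ≤ ‖residual S W‖ ^ 2 - η * gradSq S W := by
  rw [residual_gdStep]
  exact norm_sub_product_increment_sq_le _ hη hP hU hV hL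

lemma imbalance_gdStep (η : ℝ) (W : Factors m n d) :
    imbalance (gdStep S η W) = imbalance W + η ^ 2 • ((residual S W * W.2)ᵀ * (residual S W * W.2)
      - ((residual S W)ᵀ * W.1)ᵀ * ((residual S W)ᵀ * W.1)) := by
  rw [gdStep_eq]
  generalize residual S W = P
  simp only [imbalance, Matrix.transpose_add, Matrix.transpose_smul, Matrix.add_mul,
    Matrix.mul_add, Matrix.smul_mul, Matrix.mul_smul, smul_add, smul_smul, sq,
    Matrix.transpose_mul, Matrix.transpose_transpose, Matrix.mul_assoc, smul_sub]
  abel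

lemma norm_imbalance_gdStep_le (η : ℝ) (W : Factors m n d) :
    ‖imbalance (gdStep S η W)‖ ≤ ‖imbalance W‖ + η ^ 2 * gradSq S W := by
  rw [imbalance_gdStep]
  refine (norm_add_le _ _).trans ?_
  rw [norm_smul, Real.norm_of_nonneg (by positivity), gradSq]
  gcongr
  exact (norm_sub_le _ _).trans
    (add_le_add (norm_transpose_mul_self_le _) (norm_transpose_mul_self_le _))

end GradientStep

section SingularCoordinates

variable {m n d k : ℕ} {S : Matrix (Fin m) (Fin n) ℝ} {Φ : Matrix (Fin m) (Fin d) ℝ}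
  {Ψ : Matrix (Fin n) (Fin d) ℝ} {σ : Fin d → ℝ} {σ₁ σd : ℝ}

/-- A thin singular value decomposition `S = Φ diag(σ) Ψᵀ` in which `d` positive singular values,
listed in any order, lie in `[σd, σ₁]`. -/
structure IsThinSVD (S : Matrix (Fin m) (Fin n) ℝ) (Φ : Matrix (Fin m) (Fin d) ℝ)
    (Ψ : Matrix (Fin n) (Fin d) ℝ) (σ : Fin d → ℝ) (σ₁ σd : ℝ) : Prop where
  ortho_left : Φᵀ * Φ = 1
  ortho_right : Ψᵀ * Ψ = 1
  eq_mul : S = Φ * Matrix.diagonal σ * Ψᵀ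
  pos : 0 < σd
  lower : ∀ i, σd ≤ σ i
  upper : ∀ i, σ i ≤ σ₁

namespace IsThinSVD

lemma transpose (h : IsThinSVD S Φ Ψ σ σ₁ σd) : IsThinSVD Sᵀ Ψ Φ σ σ₁ σd where
  ortho_left := h.ortho_right
  ortho_right := h.ortho_left
  eq_mul := by
    rw [h.eq_mul, Matrix.transpose_mul, Matrix.transpose_mul, Matrix.transpose_transpose,
      Matrix.diagonal_transpose, Matrix.mul_assoc]
  pos := h.pos
  lower := h.lower
  upper := h.upper

lemma abs_le (h : IsThinSVD S Φ Ψ σ σ₁ σd) (i : Fin d) : |σ i| ≤ σ₁ := by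
  rw [abs_of_pos (h.pos.trans_le (h.lower i))]
  exact h.upper i

lemma norm_sq_le (h : IsThinSVD S Φ Ψ σ σ₁ σd) (hσ₁ : 0 ≤ σ₁) : ‖S‖ ^ 2 ≤ d * σ₁ ^ 2 := by
  have hΨ : ‖Ψᵀ‖ ^ 2 = d := by
    rw [Matrix.frobenius_norm_transpose, ← real_inner_self_eq_norm_sq, inner_eq_trace,
      h.ortho_right, Matrix.trace_one, Fintype.card_fin]
  calc ‖S‖ ^ 2 = ‖Matrix.diagonal σ * Ψᵀ‖ ^ 2 := by
        rw [h.eq_mul, Matrix.mul_assoc, norm_mul_eq_of_transpose_mul_self h.ortho_left]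
    _ ≤ (σ₁ * ‖Ψᵀ‖) ^ 2 := by
        gcongr
        exact norm_diagonal_mul_le h.abs_le hσ₁ _
    _ = d * σ₁ ^ 2 := by rw [mul_pow, hΨ, mul_comm]

lemma perp_eq_zero (h : IsThinSVD S Φ Ψ σ σ₁ σd) : perp Φ S = 0 := by
  rw [h.eq_mul, perp_mul, perp_mul, perp_self h.ortho_left, Matrix.zero_mul, Matrix.zero_mul]

lemma perp_residual (h : IsThinSVD S Φ Ψ σ σ₁ σd) (W : Factors m n d) :
    perp Φ (residual S W) = -(perp Φ W.1 * W.2ᵀ) := by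
  rw [residual, perp_sub, h.perp_eq_zero, perp_mul, zero_sub]

lemma perp_step (h : IsThinSVD S Φ Ψ σ σ₁ σd) (η : ℝ) (U : Matrix (Fin m) (Fin k) ℝ)
    (V : Matrix (Fin n) (Fin k) ℝ) :
    perp Φ (U + η • ((S - U * Vᵀ) * V)) = perp Φ U - η • (perp Φ U * (Vᵀ * V)) := by
  rw [perp_add, perp_smul, perp_mul, perp_sub, h.perp_eq_zero, perp_mul, zero_sub,
    Matrix.neg_mul, smul_neg, ← sub_eq_add_neg, Matrix.mul_assoc]

lemma transpose_mul_step (h : IsThinSVD S Φ Ψ σ σ₁ σd) (η : ℝ) (U : Matrix (Fin m) (Fin k) ℝ)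
    (V : Matrix (Fin n) (Fin k) ℝ) :
    Φᵀ * (U + η • ((S - U * Vᵀ) * V))
      = Φᵀ * U + η • (Matrix.diagonal σ * (Ψᵀ * V) - Φᵀ * U * (Vᵀ * V)) := by
  have hΦ : Φᵀ * (Φ * (Matrix.diagonal σ * (Ψᵀ * V))) = Matrix.diagonal σ * (Ψᵀ * V) := by
    rw [← Matrix.mul_assoc, h.ortho_left, Matrix.one_mul]
  rw [Matrix.mul_add, Matrix.mul_smul, Matrix.sub_mul, Matrix.mul_sub, h.eq_mul]
  simp only [Matrix.mul_assoc, hΦ]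

end IsThinSVD

/-- The half sum `(ΦᵀU + ΨᵀV) / 2` of the factors in singular coordinates, which grows under
gradient descent. -/
def halfSum (Φ : Matrix (Fin m) (Fin d) ℝ) (Ψ : Matrix (Fin n) (Fin d) ℝ) (W : Factors m n d) :
    Matrix (Fin d) (Fin d) ℝ :=
  (1 / 2 : ℝ) • (Φᵀ * W.1 + Ψᵀ * W.2)

/-- The half difference `(ΦᵀU - ΨᵀV) / 2` of the factors in singular coordinates, which stays
small under gradient descent. -/
def halfDiff (Φ : Matrix (Fin m) (Fin d) ℝ) (Ψ : Matrix (Fin n) (Fin d) ℝ) (W : Factors m n d) :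
    Matrix (Fin d) (Fin d) ℝ :=
  (1 / 2 : ℝ) • (Φᵀ * W.1 - Ψᵀ * W.2)

/-- The mean `(UᵀU + VᵀV) / 2` of the Gram matrices of the two factors. -/
def meanGram (W : Factors m n d) : Matrix (Fin d) (Fin d) ℝ :=
  (1 / 2 : ℝ) • (W.1ᵀ * W.1 + W.2ᵀ * W.2)

/-- The part of `meanGram` that does not come from the half sum. -/
def gramError (Φ : Matrix (Fin m) (Fin d) ℝ) (Ψ : Matrix (Fin n) (Fin d) ℝ) (W : Factors m n d) :
    Matrix (Fin d) (Fin d) ℝ :=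
  (halfDiff Φ Ψ W)ᵀ * halfDiff Φ Ψ W
    + (1 / 2 : ℝ) • ((perp Φ W.1)ᵀ * perp Φ W.1 + (perp Ψ W.2)ᵀ * perp Ψ W.2)

lemma halfSum_add_halfDiff (Φ : Matrix (Fin m) (Fin d) ℝ) (Ψ : Matrix (Fin n) (Fin d) ℝ)
    (W : Factors m n d) : halfSum Φ Ψ W + halfDiff Φ Ψ W = Φᵀ * W.1 := by
  simp only [halfSum, halfDiff]
  module

lemma halfSum_sub_halfDiff (Φ : Matrix (Fin m) (Fin d) ℝ) (Ψ : Matrix (Fin n) (Fin d) ℝ)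
    (W : Factors m n d) : halfSum Φ Ψ W - halfDiff Φ Ψ W = Ψᵀ * W.2 := by
  simp only [halfSum, halfDiff]
  module

lemma gram_fst_eq (W : Factors m n d) :
    W.1ᵀ * W.1 = meanGram W + (1 / 2 : ℝ) • imbalance W := by
  simp only [meanGram, imbalance]
  module

lemma gram_snd_eq (W : Factors m n d) :
    W.2ᵀ * W.2 = meanGram W - (1 / 2 : ℝ) • imbalance W := by
  simp only [meanGram, imbalance]
  module

lemma meanGram_eq (hΦ : Φᵀ * Φ = 1) (hΨ : Ψᵀ * Ψ = 1) (W : Factors m n d) :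
    meanGram W = (halfSum Φ Ψ W)ᵀ * halfSum Φ Ψ W + gramError Φ Ψ W := by
  rw [meanGram, gram_eq_add_gram_perp hΦ, gram_eq_add_gram_perp hΨ,
    ← halfSum_add_halfDiff Φ Ψ W, ← halfSum_sub_halfDiff Φ Ψ W, gramError]
  simp only [Matrix.transpose_add, Matrix.transpose_sub, Matrix.mul_add, Matrix.add_mul,
    Matrix.mul_sub, Matrix.sub_mul]
  module

lemma transpose_mul_gdStep_fst (h : IsThinSVD S Φ Ψ σ σ₁ σd) (η : ℝ) (W : Factors m n d) :
    Φᵀ * (gdStep S η W).1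
      = Φᵀ * W.1 + η • (Matrix.diagonal σ * (Ψᵀ * W.2) - Φᵀ * W.1 * (W.2ᵀ * W.2)) :=
  h.transpose_mul_step η W.1 W.2

lemma transpose_mul_gdStep_snd (h : IsThinSVD S Φ Ψ σ σ₁ σd) (η : ℝ) (W : Factors m n d) :
    Ψᵀ * (gdStep S η W).2
      = Ψᵀ * W.2 + η • (Matrix.diagonal σ * (Φᵀ * W.1) - Ψᵀ * W.2 * (W.1ᵀ * W.1)) := by
  rw [gdStep_snd]
  exact h.transpose.transpose_mul_step η W.2 W.1

lemma halfSum_gdStep (h : IsThinSVD S Φ Ψ σ σ₁ σd) (η : ℝ) (W : Factors m n d) :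
    halfSum Φ Ψ (gdStep S η W) = halfSum Φ Ψ W + η • (Matrix.diagonal σ * halfSum Φ Ψ W
      - halfSum Φ Ψ W * meanGram W + (1 / 2 : ℝ) • (halfDiff Φ Ψ W * imbalance W)) := by
  rw [halfSum, transpose_mul_gdStep_fst h, transpose_mul_gdStep_snd h, gram_fst_eq, gram_snd_eq,
    ← halfSum_add_halfDiff Φ Ψ W, ← halfSum_sub_halfDiff Φ Ψ W]
  simp only [Matrix.mul_add, Matrix.add_mul, Matrix.mul_sub, Matrix.sub_mul, Matrix.mul_smul]
  module

lemma halfDiff_gdStep (h : IsThinSVD S Φ Ψ σ σ₁ σd) (η : ℝ) (W : Factors m n d) :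
    halfDiff Φ Ψ (gdStep S η W) = (halfDiff Φ Ψ W - η • (Matrix.diagonal σ * halfDiff Φ Ψ W
      + halfDiff Φ Ψ W * meanGram W)) + (η / 2) • (halfSum Φ Ψ W * imbalance W) := by
  rw [halfDiff, transpose_mul_gdStep_fst h, transpose_mul_gdStep_snd h, gram_fst_eq, gram_snd_eq,
    ← halfSum_add_halfDiff Φ Ψ W, ← halfSum_sub_halfDiff Φ Ψ W]
  simp only [Matrix.mul_add, Matrix.add_mul, Matrix.mul_sub, Matrix.sub_mul, Matrix.mul_smul]
  module

lemma norm_half_smul_le {E : Type*} [SeminormedAddCommGroup E] [NormedSpace ℝ E] {a b c : E}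
    {l : ℝ} (h : ‖c‖ ≤ ‖a‖ + ‖b‖) (ha : ‖a‖ ≤ l) (hb : ‖b‖ ≤ l) : ‖(1 / 2 : ℝ) • c‖ ≤ l := by
  rw [norm_smul, Real.norm_of_nonneg (by norm_num)]
  linarith

lemma norm_meanGram_le {W : Factors m n d} {L : ℝ} (hU : ‖W.1‖ ^ 2 ≤ L) (hV : ‖W.2‖ ^ 2 ≤ L) :
    ‖meanGram W‖ ≤ L :=
  norm_half_smul_le (norm_add_le _ _) ((norm_transpose_mul_self_le _).trans hU)
    ((norm_transpose_mul_self_le _).trans hV)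

lemma norm_halfSum_le (hΦ : Φᵀ * Φ = 1) (hΨ : Ψᵀ * Ψ = 1) {W : Factors m n d} {l : ℝ}
    (hU : ‖W.1‖ ≤ l) (hV : ‖W.2‖ ≤ l) : ‖halfSum Φ Ψ W‖ ≤ l :=
  norm_half_smul_le (norm_add_le _ _) ((norm_transpose_mul_le hΦ _).trans hU)
    ((norm_transpose_mul_le hΨ _).trans hV)

lemma norm_halfDiff_le (hΦ : Φᵀ * Φ = 1) (hΨ : Ψᵀ * Ψ = 1) {W : Factors m n d} {l : ℝ}
    (hU : ‖W.1‖ ≤ l) (hV : ‖W.2‖ ≤ l) : ‖halfDiff Φ Ψ W‖ ≤ l :=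
  norm_half_smul_le (norm_sub_le _ _) ((norm_transpose_mul_le hΦ _).trans hU)
    ((norm_transpose_mul_le hΨ _).trans hV)

lemma norm_gramError_le (Φ : Matrix (Fin m) (Fin d) ℝ) (Ψ : Matrix (Fin n) (Fin d) ℝ)
    (W : Factors m n d) :
    ‖gramError Φ Ψ W‖ ≤ ‖halfDiff Φ Ψ W‖ ^ 2
      + 1 / 2 * (‖perp Φ W.1‖ ^ 2 + ‖perp Ψ W.2‖ ^ 2) := by
  refine (norm_add_le _ _).trans (add_le_add (norm_transpose_mul_self_le _) ?_)
  rw [norm_smul, Real.norm_of_nonneg (by norm_num)]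
  gcongr
  exact (norm_add_le _ _).trans
    (add_le_add (norm_transpose_mul_self_le _) (norm_transpose_mul_self_le _))

lemma inner_mul_meanGram_nonneg (B : Matrix (Fin k) (Fin d) ℝ) (W : Factors m n d) :
    0 ≤ ⟪B, B * meanGram W⟫_ℝ := by
  rw [meanGram, Matrix.mul_smul, real_inner_smul_right, Matrix.mul_add, inner_add_right,
    inner_mul_gram_self, inner_mul_gram_self]
  positivity

lemma norm_sub_smul_diagonal_mul_add_mul_meanGram_le (hσ_lower : ∀ i, σd ≤ σ i)
    (hσ : ∀ i, |σ i| ≤ σ₁) (hσ₁ : 0 ≤ σ₁) {η L : ℝ} (hη : 0 ≤ η) {W : Factors m n d}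
    (hL : ‖meanGram W‖ ≤ L) (hηL : η * (σ₁ + L) ^ 2 ≤ σd) (hησ : η * σd ≤ 1)
    (B : Matrix (Fin d) (Fin d) ℝ) :
    ‖B - η • (Matrix.diagonal σ * B + B * meanGram W)‖ ≤ (1 - η * σd / 2) * ‖B‖ := by
  have hinner : σd * ‖B‖ ^ 2 ≤ ⟪B, Matrix.diagonal σ * B + B * meanGram W⟫_ℝ := by
    rw [inner_add_right]
    linarith [mul_norm_sq_le_inner_diagonal_mul hσ_lower B, inner_mul_meanGram_nonneg B W]
  have hnorm : ‖Matrix.diagonal σ * B + B * meanGram W‖ ≤ (σ₁ + L) * ‖B‖ := by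
    calc ‖Matrix.diagonal σ * B + B * meanGram W‖
        ≤ σ₁ * ‖B‖ + ‖B‖ * ‖meanGram W‖ := (norm_add_le _ _).trans
          (add_le_add (norm_diagonal_mul_le hσ hσ₁ B) (Matrix.frobenius_norm_mul _ _))
      _ ≤ σ₁ * ‖B‖ + ‖B‖ * L := by gcongr
      _ = (σ₁ + L) * ‖B‖ := by ring
  have hquad : η ^ 2 * ‖Matrix.diagonal σ * B + B * meanGram W‖ ^ 2 ≤ η * σd * ‖B‖ ^ 2 := by
    calc η ^ 2 * ‖Matrix.diagonal σ * B + B * meanGram W‖ ^ 2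
        ≤ η ^ 2 * ((σ₁ + L) * ‖B‖) ^ 2 := by gcongr
      _ = η * (η * (σ₁ + L) ^ 2) * ‖B‖ ^ 2 := by ring
      _ ≤ η * σd * ‖B‖ ^ 2 := by gcongr
  refine le_of_sq_le_sq ?_ (mul_nonneg (by linarith) (norm_nonneg _))
  rw [norm_sub_sq_real, real_inner_smul_right, norm_smul, mul_pow, Real.norm_of_nonneg hη]
  have hinner_step := mul_le_mul_of_nonneg_left hinner hη
  have hsq_nonneg : 0 ≤ (η * σd / 2) ^ 2 * ‖B‖ ^ 2 := by positivity
  linarith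

lemma norm_halfDiff_gdStep_le (h : IsThinSVD S Φ Ψ σ σ₁ σd) (hσ₁ : 0 ≤ σ₁) {η L : ℝ}
    (hη : 0 ≤ η) {W : Factors m n d} (hL : ‖meanGram W‖ ≤ L) (hηL : η * (σ₁ + L) ^ 2 ≤ σd)
    (hησ : η * σd ≤ 1) :
    ‖halfDiff Φ Ψ (gdStep S η W)‖ ≤ (1 - η * σd / 2) * ‖halfDiff Φ Ψ W‖
      + η / 2 * (‖halfSum Φ Ψ W‖ * ‖imbalance W‖) := by
  rw [halfDiff_gdStep h]
  refine (norm_add_le _ _).trans (add_le_add ?_ ?_)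
  · exact norm_sub_smul_diagonal_mul_add_mul_meanGram_le h.lower h.abs_le hσ₁ hη hL hηL hησ _
  · rw [norm_smul, Real.norm_of_nonneg (by positivity)]
    gcongr
    exact Matrix.frobenius_norm_mul _ _

lemma BoundedBelow.halfSum_gdStep (h : IsThinSVD S Φ Ψ σ σ₁ σd) (hσ₁ : 0 ≤ σ₁)
    {η s α e ν β : ℝ} (hη : 0 < η) {W : Factors m n d} (hA : BoundedBelow (halfSum Φ Ψ W) s)
    (hs : 0 ≤ s) (hsσ : 16 * s ^ 2 ≤ σd) (hα : ‖halfSum Φ Ψ W‖ ≤ α)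
    (he : ‖gramError Φ Ψ W‖ ≤ e) (heσ : 16 * e ≤ σd) (hν : ‖meanGram W‖ ≤ ν)
    (hβ : ‖halfDiff Φ Ψ W‖ * ‖imbalance W‖ ≤ β) (hηα : 4 * (η * α ^ 2) ≤ 1)
    (hησ : η * σd ≤ 1) (hησ₁ : η * σ₁ ≤ 1)
    (herr : 2 * η * (α ^ 3 * e) + η * (σ₁ * (α * ν)) + 1 / 2 * β ≤ σd * s / 4) :
    BoundedBelow (halfSum Φ Ψ (gdStep S η W)) ((1 + η * σd / 4) * s) := by
  have hgram := meanGram_eq h.ortho_left h.ortho_right W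
  have hforcing : ‖(1 / 2 : ℝ) • (halfDiff Φ Ψ W * imbalance W)‖ ≤ 1 / 2 * β := by
    rw [norm_smul, Real.norm_of_nonneg (by norm_num)]
    gcongr
    exact (Matrix.frobenius_norm_mul _ _).trans hβ
  rw [MatFac.halfSum_gdStep h, hgram]
  exact growth hη h.pos h.lower h.abs_le hσ₁ hA hs hsσ hα he heσ (hgram ▸ hν) hforcing hηα hησ
    hησ₁ herr

lemma BoundedBelow.mul_norm_mul_sq_sub_le {p q ι : Type*} [Fintype p] [Fintype q]
    [Fintype ι] {s : ℝ} {Ψ V : Matrix q ι ℝ} (hV : BoundedBelow (Ψᵀ * V) s) (hs : 0 < s)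
    (P : Matrix p q ℝ) :
    s ^ 2 / 2 * ‖P * Ψ‖ ^ 2 - ‖P‖ ^ 2 * ‖perp Ψ V‖ ^ 2 ≤ ‖P * V‖ ^ 2 := by
  classical
  have hsplit : P * Ψ * (Ψᵀ * V) = P * V - P * perp Ψ V := by
    rw [perp, Matrix.mul_sub, Matrix.mul_assoc]
    abel
  have hlower : s * ‖P * Ψ‖ ≤ ‖P * Ψ * (Ψᵀ * V)‖ := by
    have := (hV.transpose hs).norm_mul_le (P * Ψ)ᵀ
    rwa [← Matrix.transpose_mul, Matrix.frobenius_norm_transpose,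
      Matrix.frobenius_norm_transpose] at this
  have hperp : ‖P * perp Ψ V‖ ^ 2 ≤ ‖P‖ ^ 2 * ‖perp Ψ V‖ ^ 2 := by
    rw [← mul_pow]
    gcongr
    exact Matrix.frobenius_norm_mul _ _
  have hsum : s ^ 2 * ‖P * Ψ‖ ^ 2 ≤ 2 * (‖P * V‖ ^ 2 + ‖P * perp Ψ V‖ ^ 2) := by
    calc s ^ 2 * ‖P * Ψ‖ ^ 2 = (s * ‖P * Ψ‖) ^ 2 := by ring
      _ ≤ (‖P * V‖ + ‖P * perp Ψ V‖) ^ 2 := by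
          gcongr
          exact hlower.trans (hsplit ▸ norm_sub_le _ _)
      _ ≤ 2 * (‖P * V‖ ^ 2 + ‖P * perp Ψ V‖ ^ 2) := add_sq_le
  linarith

lemma norm_residual_sq_le (h : IsThinSVD S Φ Ψ σ σ₁ σd) (W : Factors m n d) :
    ‖residual S W‖ ^ 2 ≤ ‖residual S W * Ψ‖ ^ 2 + ‖(residual S W)ᵀ * Φ‖ ^ 2
      + ‖perp Φ W.1‖ ^ 2 * ‖perp Ψ W.2‖ ^ 2 := by
  set P := residual S W
  have hleft : ‖P‖ ^ 2 = ‖Pᵀ * Φ‖ ^ 2 + ‖perp Φ P‖ ^ 2 := by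
    rw [norm_sq_eq_add_norm_perp_sq h.ortho_left, ← Matrix.frobenius_norm_transpose (Φᵀ * P),
      Matrix.transpose_mul, Matrix.transpose_transpose]
  have hright := norm_sq_eq_add_norm_perp_sq h.ortho_right (perp Φ P)ᵀ
  have hmixed : ‖Ψᵀ * (perp Φ P)ᵀ‖ ≤ ‖P * Ψ‖ := by
    rw [← Matrix.transpose_mul, Matrix.frobenius_norm_transpose, ← perp_mul]
    exact norm_perp_le h.ortho_left _
  have hcorner : ‖perp Ψ (perp Φ P)ᵀ‖ ≤ ‖perp Φ W.1‖ * ‖perp Ψ W.2‖ := by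
    have hPerp : (perp Φ P)ᵀ = W.2 * (-(perp Φ W.1))ᵀ := by
      rw [h.perp_residual, ← Matrix.neg_mul, Matrix.transpose_mul, Matrix.transpose_transpose]
    rw [hPerp, perp_mul, mul_comm]
    exact (norm_mul_transpose_le _ _).trans_eq (by rw [norm_neg])
  have hmixed_sq := pow_le_pow_left₀ (norm_nonneg _) hmixed 2
  have hcorner_sq := pow_le_pow_left₀ (norm_nonneg _) hcorner 2
  rw [Matrix.frobenius_norm_transpose] at hright
  rw [mul_pow] at hcorner_sq
  linarith

/-- A Polyak–Łojasiewicz inequality, up to the product of the components of the two factors outside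
the singular spaces. -/
lemma norm_residual_sq_le_gradSq (h : IsThinSVD S Φ Ψ σ σ₁ σd) {s : ℝ} (hs : 0 < s)
    {W : Factors m n d} (hU : BoundedBelow (Φᵀ * W.1) s) (hV : BoundedBelow (Ψᵀ * W.2) s)
    (hperp : 4 * (‖perp Φ W.1‖ ^ 2 + ‖perp Ψ W.2‖ ^ 2) ≤ s ^ 2) :
    s ^ 2 / 4 * ‖residual S W‖ ^ 2 - s ^ 2 / 2 * (‖perp Φ W.1‖ ^ 2 * ‖perp Ψ W.2‖ ^ 2)
      ≤ gradSq S W := by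
  have hright := hV.mul_norm_mul_sq_sub_le hs (residual S W)
  have hleft := hU.mul_norm_mul_sq_sub_le hs (residual S W)ᵀ
  rw [Matrix.frobenius_norm_transpose] at hleft
  have hdecomp := mul_le_mul_of_nonneg_left (norm_residual_sq_le h W) (sq_nonneg s)
  have hsmall := mul_le_mul_of_nonneg_left hperp (sq_nonneg ‖residual S W‖)
  rw [gradSq]
  linarith

end SingularCoordinates

section Convergence

/-- The conditions on the size `r` of the initialization, the lower bound `s₀` for the singular
values of the initial half sum and the step size `η` under which gradient descent converges. The
factors have Frobenius norm at most `l = √(5 d σ₁)` along the trajectory. -/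
structure SmallParams (d : ℕ) (σ₁ σd η r s₀ l : ℝ) : Prop where
  step_pos : 0 < η
  r_nonneg : 0 ≤ r
  s_pos : 0 < s₀
  σd_pos : 0 < σd
  σd_le : σd ≤ σ₁
  one_le_d : 1 ≤ (d : ℝ)
  l_nonneg : 0 ≤ l
  l_sq : l ^ 2 = 5 * (d * σ₁)
  r_sq_le : 1000 * r ^ 2 ≤ σd
  l_mul_r_le : 3 * (l * r) ≤ σd
  r_cube_le : 12 * r ^ 3 ≤ σd * s₀
  step_growth : 40 * (η * (σ₁ * l ^ 3)) ≤ σd * s₀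
  step_drift : 4 * (η * (d * σ₁ ^ 2)) ≤ r ^ 2
  step_smooth : 8 * (η * (l ^ 2) ^ 2) ≤ σd
  s_sq_le : 16 * s₀ ^ 2 ≤ σd

namespace SmallParams

variable {d : ℕ} {σ₁ σd η r s₀ l : ℝ}

lemma σ₁_pos (h : SmallParams d σ₁ σd η r s₀ l) : 0 < σ₁ := h.σd_pos.trans_le h.σd_le

lemma five_mul_σ₁_le (h : SmallParams d σ₁ σd η r s₀ l) : 5 * σ₁ ≤ l ^ 2 := by
  rw [h.l_sq]
  linarith [le_mul_of_one_le_left h.σ₁_pos.le h.one_le_d]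

lemma step_mul_l_sq (h : SmallParams d σ₁ σd η r s₀ l) : η * l ^ 2 ≤ 1 / 8 := by
  have hl : 0 < l ^ 2 := by linarith [h.five_mul_σ₁_le, h.σ₁_pos]
  refine le_of_mul_le_mul_right ?_ hl
  linarith [h.step_smooth, h.five_mul_σ₁_le, h.σd_le, h.σd_pos]

lemma step_mul_σ₁ (h : SmallParams d σ₁ σd η r s₀ l) : η * σ₁ ≤ 1 / 8 := by
  have hη := h.step_pos
  refine le_trans ?_ h.step_mul_l_sq
  gcongr
  linarith [h.five_mul_σ₁_le, h.σ₁_pos]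

lemma step_mul_σd (h : SmallParams d σ₁ σd η r s₀ l) : η * σd ≤ 1 / 8 :=
  (mul_le_mul_of_nonneg_left h.σd_le h.step_pos.le).trans h.step_mul_σ₁

lemma r_sq_le_σ₁ (h : SmallParams d σ₁ σd η r s₀ l) : 1000 * r ^ 2 ≤ σ₁ :=
  h.r_sq_le.trans h.σd_le

lemma σ₁_sq_le (h : SmallParams d σ₁ σd η r s₀ l) : σ₁ ^ 2 ≤ d * σ₁ ^ 2 :=
  le_mul_of_one_le_left (sq_nonneg _) h.one_le_d

lemma step_mul_add_sq_le (h : SmallParams d σ₁ σd η r s₀ l) : η * (σ₁ + l ^ 2) ^ 2 ≤ σd := by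
  have hη := h.step_pos
  have hσ₁ := h.σ₁_pos
  calc η * (σ₁ + l ^ 2) ^ 2 ≤ η * (l ^ 2 + l ^ 2) ^ 2 := by
        gcongr
        linarith [h.five_mul_σ₁_le]
    _ = 4 * (η * (l ^ 2) ^ 2) := by ring
    _ ≤ σd := by linarith [h.step_smooth, mul_nonneg hη.le (sq_nonneg (l ^ 2))]

end SmallParams

variable {m n d : ℕ} {S : Matrix (Fin m) (Fin n) ℝ} {Φ : Matrix (Fin m) (Fin d) ℝ}
  {Ψ : Matrix (Fin n) (Fin d) ℝ} {σ : Fin d → ℝ} {σ₁ σd η r s₀ l : ℝ} {W : Factors m n d}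

/-- The invariants of the trajectory other than the growth of the half sum. The drift of the
imbalance is paid for by the decrease of the residual, so the two are bounded together. -/
structure Controlled (S : Matrix (Fin m) (Fin n) ℝ) (Φ : Matrix (Fin m) (Fin d) ℝ)
    (Ψ : Matrix (Fin n) (Fin d) ℝ) (σ₁ η r : ℝ) (W : Factors m n d) : Prop where
  residual_le : ‖residual S W‖ ^ 2 ≤ 4 * (d * σ₁ ^ 2)
  drift_le : ‖imbalance W‖ + η * ‖residual S W‖ ^ 2 ≤ 3 * r ^ 2
  left_le : ‖perp Φ W.1‖ ≤ r
  right_le : ‖perp Ψ W.2‖ ≤ r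
  diff_le : ‖halfDiff Φ Ψ W‖ ≤ r

namespace Controlled

lemma imbalance_le (hη : 0 ≤ η) (hW : Controlled S Φ Ψ σ₁ η r W) :
    ‖imbalance W‖ ≤ 3 * r ^ 2 :=
  (le_add_of_nonneg_right (by positivity)).trans hW.drift_le

lemma norm_product_sq_le (h : IsThinSVD S Φ Ψ σ σ₁ σd) (hp : SmallParams d σ₁ σd η r s₀ l)
    (hW : Controlled S Φ Ψ σ₁ η r W) : ‖W.1 * W.2ᵀ‖ ^ 2 ≤ 9 * (d * σ₁ ^ 2) := by
  have hS := h.norm_sq_le hp.σ₁_pos.le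
  have hsub : ‖W.1 * W.2ᵀ‖ ≤ ‖S‖ + ‖residual S W‖ := by
    calc ‖W.1 * W.2ᵀ‖ = ‖S - residual S W‖ := by rw [residual, sub_sub_cancel]
      _ ≤ ‖S‖ + ‖residual S W‖ := norm_sub_le _ _
  have hsq := pow_le_pow_left₀ (norm_nonneg _) hsub 2
  linarith [sq_nonneg (2 * ‖S‖ - ‖residual S W‖), hW.residual_le]

lemma norm_sq_le_of_norm_gram_sq_le {p : ℕ} (hp : SmallParams d σ₁ σd η r s₀ l)
    {U : Matrix (Fin p) (Fin d) ℝ} (hU : ‖Uᵀ * U‖ ^ 2 ≤ 19 * (d * σ₁ ^ 2)) :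
    ‖U‖ ^ 2 ≤ l ^ 2 := by
  refine le_of_sq_le_sq ?_ (sq_nonneg _)
  calc (‖U‖ ^ 2) ^ 2 ≤ d * ‖Uᵀ * U‖ ^ 2 := by simpa only [Fintype.card_fin] using norm_pow_four_le U
    _ ≤ d * (19 * (d * σ₁ ^ 2)) := by gcongr
    _ ≤ (l ^ 2) ^ 2 := by
        rw [hp.l_sq]
        linarith [sq_nonneg ((d : ℝ) * σ₁)]

lemma factors_sq_le (h : IsThinSVD S Φ Ψ σ σ₁ σd) (hp : SmallParams d σ₁ σd η r s₀ l)
    (hW : Controlled S Φ Ψ σ₁ η r W) : ‖W.1‖ ^ 2 ≤ l ^ 2 ∧ ‖W.2‖ ^ 2 ≤ l ^ 2 := by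
  have himbalance : ‖imbalance W‖ ^ 2 ≤ d * σ₁ ^ 2 := by
    refine (pow_le_pow_left₀ (norm_nonneg _) ?_ 2).trans hp.σ₁_sq_le
    linarith [hW.imbalance_le hp.step_pos.le, hp.r_sq_le_σ₁, sq_nonneg r]
  have hgram := norm_gram_sq_add_norm_gram_sq W.1 W.2
  rw [← imbalance] at hgram
  have hproduct := hW.norm_product_sq_le h hp
  exact ⟨norm_sq_le_of_norm_gram_sq_le hp (by linarith [sq_nonneg ‖W.2ᵀ * W.2‖]),
    norm_sq_le_of_norm_gram_sq_le hp (by linarith [sq_nonneg ‖W.1ᵀ * W.1‖])⟩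

lemma factors_le (h : IsThinSVD S Φ Ψ σ σ₁ σd) (hp : SmallParams d σ₁ σd η r s₀ l)
    (hW : Controlled S Φ Ψ σ₁ η r W) : ‖W.1‖ ≤ l ∧ ‖W.2‖ ≤ l :=
  (hW.factors_sq_le h hp).imp (le_of_sq_le_sq · hp.l_nonneg) (le_of_sq_le_sq · hp.l_nonneg)

lemma residual_step_sq_le (h : IsThinSVD S Φ Ψ σ σ₁ σd) (hp : SmallParams d σ₁ σd η r s₀ l)
    (hW : Controlled S Φ Ψ σ₁ η r W) :
    ‖residual S (gdStep S η W)‖ ^ 2 ≤ ‖residual S W‖ ^ 2 - η * gradSq S W := by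
  obtain ⟨hU, hV⟩ := hW.factors_sq_le h hp
  refine norm_residual_gdStep_sq_le S hp.step_pos.le (le_of_sq_le_sq ?_ (sq_nonneg _)) hU hV
    hp.step_mul_l_sq
  calc ‖residual S W‖ ^ 2 ≤ 4 * (d * σ₁ ^ 2) := hW.residual_le
    _ ≤ 25 * (d * (d * σ₁ ^ 2)) := by
        linarith [le_mul_of_one_le_left (mul_nonneg d.cast_nonneg (sq_nonneg σ₁)) hp.one_le_d,
          hp.σ₁_sq_le, sq_nonneg σ₁]
    _ = (l ^ 2) ^ 2 := by
        rw [hp.l_sq]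
        ring

lemma perp_fst_step_sq_le (h : IsThinSVD S Φ Ψ σ σ₁ σd) (hp : SmallParams d σ₁ σd η r s₀ l)
    (hW : Controlled S Φ Ψ σ₁ η r W) :
    ‖perp Φ (gdStep S η W).1‖ ^ 2 ≤ ‖perp Φ W.1‖ ^ 2 - η * ‖perp Φ W.1 * W.2ᵀ‖ ^ 2 := by
  rw [show (gdStep S η W).1 = W.1 + η • ((S - W.1 * W.2ᵀ) * W.2) from rfl, h.perp_step]
  refine norm_sub_mul_gram_sq_le _ _ hp.step_pos.le ?_
  linarith [mul_le_mul_of_nonneg_left (hW.factors_sq_le h hp).2 hp.step_pos.le, hp.step_mul_l_sq]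

lemma perp_snd_step_sq_le (h : IsThinSVD S Φ Ψ σ σ₁ σd) (hp : SmallParams d σ₁ σd η r s₀ l)
    (hW : Controlled S Φ Ψ σ₁ η r W) :
    ‖perp Ψ (gdStep S η W).2‖ ^ 2 ≤ ‖perp Ψ W.2‖ ^ 2 := by
  rw [gdStep_snd, h.transpose.perp_step]
  refine (norm_sub_mul_gram_sq_le _ _ hp.step_pos.le ?_).trans
    (sub_le_self _ (mul_nonneg hp.step_pos.le (sq_nonneg _)))
  linarith [mul_le_mul_of_nonneg_left (hW.factors_sq_le h hp).1 hp.step_pos.le, hp.step_mul_l_sq]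

lemma halfDiff_step_le (h : IsThinSVD S Φ Ψ σ σ₁ σd) (hp : SmallParams d σ₁ σd η r s₀ l)
    (hW : Controlled S Φ Ψ σ₁ η r W) : ‖halfDiff Φ Ψ (gdStep S η W)‖ ≤ r := by
  have hη := hp.step_pos
  have hr := hp.r_nonneg
  have hl := hp.l_nonneg
  have hησ := hp.step_mul_σd
  obtain ⟨hU, hV⟩ := hW.factors_sq_le h hp
  obtain ⟨hU', hV'⟩ := hW.factors_le h hp
  have hforcing : ‖halfSum Φ Ψ W‖ * ‖imbalance W‖ ≤ σd * r := by
    calc ‖halfSum Φ Ψ W‖ * ‖imbalance W‖ ≤ l * (3 * r ^ 2) := by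
          gcongr
          · exact norm_halfSum_le h.ortho_left h.ortho_right hU' hV'
          · exact hW.imbalance_le hη.le
      _ = 3 * (l * r) * r := by ring
      _ ≤ σd * r := by gcongr; exact hp.l_mul_r_le
  calc ‖halfDiff Φ Ψ (gdStep S η W)‖
      ≤ (1 - η * σd / 2) * ‖halfDiff Φ Ψ W‖ + η / 2 * (‖halfSum Φ Ψ W‖ * ‖imbalance W‖) :=
        norm_halfDiff_gdStep_le h hp.σ₁_pos.le hη.le (norm_meanGram_le hU hV)
          hp.step_mul_add_sq_le (by linarith)
    _ ≤ (1 - η * σd / 2) * r + η / 2 * (σd * r) := by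
        gcongr
        · linarith
        · exact hW.diff_le
    _ = r := by ring

lemma step (h : IsThinSVD S Φ Ψ σ σ₁ σd) (hp : SmallParams d σ₁ σd η r s₀ l)
    (hW : Controlled S Φ Ψ σ₁ η r W) : Controlled S Φ Ψ σ₁ η r (gdStep S η W) where
  residual_le := (hW.residual_step_sq_le h hp).trans
    ((sub_le_self _ (mul_nonneg hp.step_pos.le (gradSq_nonneg S W))).trans hW.residual_le)
  drift_le := by
    linarith [norm_imbalance_gdStep_le S η W, hW.drift_le,
      mul_le_mul_of_nonneg_left (hW.residual_step_sq_le h hp) hp.step_pos.le]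
  left_le := by
    refine (le_of_sq_le_sq ((hW.perp_fst_step_sq_le h hp).trans ?_) (norm_nonneg _)).trans
      hW.left_le
    exact sub_le_self _ (mul_nonneg hp.step_pos.le (sq_nonneg _))
  right_le := (le_of_sq_le_sq (hW.perp_snd_step_sq_le h hp) (norm_nonneg _)).trans hW.right_le
  diff_le := hW.halfDiff_step_le h hp

lemma iter (h : IsThinSVD S Φ Ψ σ σ₁ σd) (hp : SmallParams d σ₁ σd η r s₀ l)
    (hW : Controlled S Φ Ψ σ₁ η r W) (t : ℕ) : Controlled S Φ Ψ σ₁ η r (gdIter S η W t) := by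
  induction t with
  | zero => exact hW
  | succ t ih =>
    rw [gdIter_succ]
    exact ih.step h hp

lemma of_norm_sq_add_le (h : IsThinSVD S Φ Ψ σ σ₁ σd) (hp : SmallParams d σ₁ σd η r s₀ l)
    (hr : ‖W.1‖ ^ 2 + ‖W.2‖ ^ 2 ≤ r ^ 2) : Controlled S Φ Ψ σ₁ η r W := by
  have hU : ‖W.1‖ ≤ r := le_of_sq_le_sq (by linarith [sq_nonneg ‖W.2‖]) hp.r_nonneg
  have hV : ‖W.2‖ ≤ r := le_of_sq_le_sq (by linarith [sq_nonneg ‖W.1‖]) hp.r_nonneg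
  have hresidual : ‖residual S W‖ ^ 2 ≤ 4 * (d * σ₁ ^ 2) := by
    have hproduct : ‖W.1 * W.2ᵀ‖ ≤ σ₁ := by
      linarith [norm_mul_transpose_le W.1 W.2, two_mul_le_add_sq ‖W.1‖ ‖W.2‖, hp.r_sq_le_σ₁,
        sq_nonneg r]
    have hsub := pow_le_pow_left₀ (norm_nonneg _) (norm_sub_le S (W.1 * W.2ᵀ)) 2
    rw [residual]
    linarith [h.norm_sq_le hp.σ₁_pos.le, pow_le_pow_left₀ (norm_nonneg _) hproduct 2,
      hp.σ₁_sq_le, sq_nonneg (‖S‖ - ‖W.1 * W.2ᵀ‖)]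
  refine ⟨hresidual, ?_, (norm_perp_le h.ortho_left _).trans hU,
    (norm_perp_le h.ortho_right _).trans hV, norm_halfDiff_le h.ortho_left h.ortho_right hU hV⟩
  have himbalance : ‖imbalance W‖ ≤ ‖W.1‖ ^ 2 + ‖W.2‖ ^ 2 :=
    (norm_sub_le _ _).trans
      (add_le_add (norm_transpose_mul_self_le _) (norm_transpose_mul_self_le _))
  linarith [mul_le_mul_of_nonneg_left hresidual hp.step_pos.le, hp.step_drift, sq_nonneg r]

lemma norm_gramError_le (hW : Controlled S Φ Ψ σ₁ η r W) : ‖gramError Φ Ψ W‖ ≤ 2 * r ^ 2 := by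
  linarith [MatFac.norm_gramError_le Φ Ψ W, pow_le_pow_left₀ (norm_nonneg _) hW.diff_le 2,
    pow_le_pow_left₀ (norm_nonneg _) hW.left_le 2, pow_le_pow_left₀ (norm_nonneg _) hW.right_le 2]

lemma boundedBelow_halfSum_step {s : ℝ} (h : IsThinSVD S Φ Ψ σ σ₁ σd)
    (hp : SmallParams d σ₁ σd η r s₀ l) (hW : Controlled S Φ Ψ σ₁ η r W) (hs : s₀ ≤ s)
    (hsσ : 16 * s ^ 2 ≤ σd) (hA : BoundedBelow (halfSum Φ Ψ W) s) :
    BoundedBelow (halfSum Φ Ψ (gdStep S η W)) ((1 + η * σd / 4) * s) := by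
  have hη := hp.step_pos
  have hσ₁ := hp.σ₁_pos
  have hl := hp.l_nonneg
  obtain ⟨hU, hV⟩ := hW.factors_sq_le h hp
  obtain ⟨hU', hV'⟩ := hW.factors_le h hp
  have hforcing : ‖halfDiff Φ Ψ W‖ * ‖imbalance W‖ ≤ r * (3 * r ^ 2) :=
    mul_le_mul hW.diff_le (hW.imbalance_le hη.le) (norm_nonneg _) hp.r_nonneg
  have hremainder :
      2 * η * (l ^ 3 * (2 * r ^ 2)) + η * (σ₁ * (l * l ^ 2)) + 1 / 2 * (r * (3 * r ^ 2))
        ≤ σd * s / 4 := by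
    have hr : η * (l ^ 3 * (1000 * r ^ 2)) ≤ η * (l ^ 3 * σ₁) := by
      gcongr
      exact hp.r_sq_le_σ₁
    have hs' : σd * s₀ ≤ σd * s := mul_le_mul_of_nonneg_left hs hp.σd_pos.le
    have hlr : 0 ≤ η * (l ^ 3 * σ₁) := by positivity
    linarith [hp.step_growth, hp.r_cube_le]
  exact hA.halfSum_gdStep h hσ₁.le hη (hp.s_pos.le.trans hs) hsσ
    (norm_halfSum_le h.ortho_left h.ortho_right hU' hV') hW.norm_gramError_le
    (by linarith [hp.r_sq_le, sq_nonneg r]) (norm_meanGram_le hU hV) hforcing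
    (by linarith [hp.step_mul_l_sq]) (by linarith [hp.step_mul_σd])
    (by linarith [hp.step_mul_σ₁]) hremainder

lemma boundedBelow_halfSum_iter (h : IsThinSVD S Φ Ψ σ σ₁ σd)
    (hp : SmallParams d σ₁ σd η r s₀ l) (hW : Controlled S Φ Ψ σ₁ η r W)
    (hA : BoundedBelow (halfSum Φ Ψ W) s₀) (t : ℕ) :
    BoundedBelow (halfSum Φ Ψ (gdIter S η W t)) (min (√σd / 4) ((1 + η * σd / 4) ^ t * s₀)) := by
  have hrate : 0 ≤ η * σd / 4 := by
    have := hp.step_pos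
    have := hp.σd_pos
    positivity
  induction t with
  | zero => exact hA.mono ((min_le_right _ _).trans (by rw [pow_zero, one_mul]))
  | succ t ih =>
    rw [gdIter_succ]
    set s := min (√σd / 4) ((1 + η * σd / 4) ^ t * s₀) with hs_def
    have hs₀ : s₀ ≤ √σd / 4 := by
      linarith [Real.le_sqrt_of_sq_le (show (4 * s₀) ^ 2 ≤ σd by linarith [hp.s_sq_le])]
    have hs : s₀ ≤ s :=
      le_min hs₀ (le_mul_of_one_le_left hp.s_pos.le (one_le_pow₀ (by linarith)))
    have hsσ : 16 * s ^ 2 ≤ σd := by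
      linarith [pow_le_pow_left₀ (hp.s_pos.le.trans hs) (min_le_left _ _) 2,
        Real.sq_sqrt hp.σd_pos.le]
    refine ((hW.iter h hp t).boundedBelow_halfSum_step h hp hs hsσ ih).mono ?_
    rw [hs_def, mul_min_of_nonneg _ _ (by linarith)]
    exact min_le_min (le_mul_of_one_le_left (by positivity) (by linarith))
      (by rw [pow_succ', mul_assoc])

lemma boundedBelow_projections (hp : SmallParams d σ₁ σd η r s₀ l)
    (hW : Controlled S Φ Ψ σ₁ η r W) (hA : BoundedBelow (halfSum Φ Ψ W) (√σd / 4)) :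
    BoundedBelow (Φᵀ * W.1) (√σd / 8) ∧ BoundedBelow (Ψᵀ * W.2) (√σd / 8) := by
  have hr : r ≤ √σd / 8 := by
    refine le_of_sq_le_sq ?_ (by positivity)
    rw [div_pow, Real.sq_sqrt hp.σd_pos.le]
    linarith [hp.r_sq_le, hp.σd_pos]
  constructor
  · rw [← halfSum_add_halfDiff Φ Ψ W]
    exact (hA.add hW.diff_le).mono (by linarith)
  · rw [← halfSum_sub_halfDiff Φ Ψ W]
    exact (hA.sub hW.diff_le).mono (by linarith)

end Controlled

/-- The squared residual plus the product of the squared components outside the singular spaces,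
a Lyapunov function for the final phase of gradient descent. -/
def lyapunov (S : Matrix (Fin m) (Fin n) ℝ) (Φ : Matrix (Fin m) (Fin d) ℝ)
    (Ψ : Matrix (Fin n) (Fin d) ℝ) (W : Factors m n d) : ℝ :=
  ‖residual S W‖ ^ 2 + ‖perp Φ W.1‖ ^ 2 * ‖perp Ψ W.2‖ ^ 2

lemma loss_le_lyapunov : loss S W.1 W.2 ≤ lyapunov S Φ Ψ W := by
  rw [loss_eq_residual, lyapunov]
  linarith [sq_nonneg ‖residual S W‖, mul_nonneg (sq_nonneg ‖perp Φ W.1‖) (sq_nonneg ‖perp Ψ W.2‖)]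

namespace Controlled

lemma lyapunov_le (hp : SmallParams d σ₁ σd η r s₀ l) (hW : Controlled S Φ Ψ σ₁ η r W) :
    lyapunov S Φ Ψ W ≤ 5 * (d * σ₁ ^ 2) := by
  have hσ₁ := hp.σ₁_pos
  have hr : r ^ 2 ≤ σ₁ := by linarith [hp.r_sq_le_σ₁, sq_nonneg r]
  have hperp : ‖perp Φ W.1‖ ^ 2 * ‖perp Ψ W.2‖ ^ 2 ≤ σ₁ ^ 2 := by
    calc ‖perp Φ W.1‖ ^ 2 * ‖perp Ψ W.2‖ ^ 2 ≤ r ^ 2 * r ^ 2 := by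
          gcongr
          · exact hW.left_le
          · exact hW.right_le
      _ ≤ σ₁ * σ₁ := by gcongr
      _ = σ₁ ^ 2 := (sq σ₁).symm
  rw [lyapunov]
  linarith [hW.residual_le, hp.σ₁_sq_le]

lemma perp_fst_step_sq_le_mul (h : IsThinSVD S Φ Ψ σ σ₁ σd) (hp : SmallParams d σ₁ σd η r s₀ l)
    (hW : Controlled S Φ Ψ σ₁ η r W) (hV : BoundedBelow (Ψᵀ * W.2) (√σd / 8)) :
    ‖perp Φ (gdStep S η W).1‖ ^ 2 ≤ (1 - η * σd / 64) * ‖perp Φ W.1‖ ^ 2 := by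
  have hlower : √σd / 8 * ‖perp Φ W.1‖ ≤ ‖perp Φ W.1 * W.2ᵀ‖ := by
    calc √σd / 8 * ‖perp Φ W.1‖ = √σd / 8 * ‖(perp Φ W.1)ᵀ‖ := by
          rw [Matrix.frobenius_norm_transpose]
      _ ≤ ‖Ψᵀ * W.2 * (perp Φ W.1)ᵀ‖ := hV.norm_mul_le _
      _ ≤ ‖W.2 * (perp Φ W.1)ᵀ‖ := by
          rw [Matrix.mul_assoc]
          exact norm_transpose_mul_le h.ortho_right _
      _ = ‖perp Φ W.1 * W.2ᵀ‖ := norm_mul_transpose_comm _ _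
  have hlower_sq := pow_le_pow_left₀ (by positivity) hlower 2
  rw [mul_pow, div_pow, Real.sq_sqrt hp.σd_pos.le] at hlower_sq
  linarith [hW.perp_fst_step_sq_le h hp, mul_le_mul_of_nonneg_left hlower_sq hp.step_pos.le]

lemma lyapunov_step_le (h : IsThinSVD S Φ Ψ σ σ₁ σd) (hp : SmallParams d σ₁ σd η r s₀ l)
    (hW : Controlled S Φ Ψ σ₁ η r W) (hA : BoundedBelow (halfSum Φ Ψ W) (√σd / 4)) :
    lyapunov S Φ Ψ (gdStep S η W) ≤ (1 - η * σd / 256) * lyapunov S Φ Ψ W := by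
  have hη := hp.step_pos
  have hσd := hp.σd_pos
  obtain ⟨hU, hV⟩ := hW.boundedBelow_projections hp hA
  have hs_sq : (√σd / 8) ^ 2 = σd / 64 := by
    rw [div_pow, Real.sq_sqrt hσd.le]
    norm_num
  have hgrad := norm_residual_sq_le_gradSq h (by positivity) hU hV (by
    linarith [hp.r_sq_le, pow_le_pow_left₀ (norm_nonneg _) hW.left_le 2,
      pow_le_pow_left₀ (norm_nonneg _) hW.right_le 2])
  rw [hs_sq] at hgrad
  have hgrad_step := mul_le_mul_of_nonneg_left hgrad hη.le
  have hfst := hW.perp_fst_step_sq_le_mul h hp hV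
  have hperp : ‖perp Φ (gdStep S η W).1‖ ^ 2 * ‖perp Ψ (gdStep S η W).2‖ ^ 2
      ≤ (1 - η * σd / 64) * ‖perp Φ W.1‖ ^ 2 * ‖perp Ψ W.2‖ ^ 2 :=
    mul_le_mul hfst (hW.perp_snd_step_sq_le h hp) (sq_nonneg _) ((sq_nonneg _).trans hfst)
  have hnonneg : 0 ≤ η * σd * (‖perp Φ W.1‖ ^ 2 * ‖perp Ψ W.2‖ ^ 2) := by positivity
  rw [lyapunov, lyapunov]
  linarith [hW.residual_step_sq_le h hp]

lemma lyapunov_iter_le (h : IsThinSVD S Φ Ψ σ σ₁ σd) (hp : SmallParams d σ₁ σd η r s₀ l)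
    (hW : Controlled S Φ Ψ σ₁ η r W) (hA : BoundedBelow (halfSum Φ Ψ W) s₀) {t₁ : ℕ}
    (ht₁ : √σd / 4 ≤ (1 + η * σd / 4) ^ t₁ * s₀) (t : ℕ) :
    lyapunov S Φ Ψ (gdIter S η W (t₁ + t)) ≤ 5 * (d * σ₁ ^ 2) * (1 - η * σd / 256) ^ t := by
  induction t with
  | zero =>
    rw [pow_zero, mul_one]
    exact (hW.iter h hp _).lyapunov_le hp
  | succ t ih =>
    have hgrown : BoundedBelow (halfSum Φ Ψ (gdIter S η W (t₁ + t))) (√σd / 4) := by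
      refine (hW.boundedBelow_halfSum_iter h hp hA (t₁ + t)).mono (le_min le_rfl (ht₁.trans ?_))
      have hs₀ := hp.s_pos
      gcongr
      · exact le_add_of_nonneg_right (by linarith [mul_pos hp.step_pos hp.σd_pos])
      · exact Nat.le_add_right _ _
    rw [← add_assoc, gdIter_succ]
    calc lyapunov S Φ Ψ (gdStep S η (gdIter S η W (t₁ + t)))
        ≤ (1 - η * σd / 256) * lyapunov S Φ Ψ (gdIter S η W (t₁ + t)) :=
          (hW.iter h hp _).lyapunov_step_le h hp hgrown
      _ ≤ (1 - η * σd / 256) * (5 * (d * σ₁ ^ 2) * (1 - η * σd / 256) ^ t) := by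
          gcongr
          linarith [hp.step_mul_σd]
      _ = 5 * (d * σ₁ ^ 2) * (1 - η * σd / 256) ^ (t + 1) := by ring

end Controlled

theorem loss_gdIter_le (h : IsThinSVD S Φ Ψ σ σ₁ σd) (hp : SmallParams d σ₁ σd η r s₀ l)
    (hr : ‖W.1‖ ^ 2 + ‖W.2‖ ^ 2 ≤ r ^ 2) (hA : BoundedBelow (halfSum Φ Ψ W) s₀) {t₁ : ℕ}
    (ht₁ : √σd / 4 ≤ (1 + η * σd / 4) ^ t₁ * s₀) (t : ℕ) :
    loss S (gdIter S η W (t₁ + t)).1 (gdIter S η W (t₁ + t)).2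
      ≤ 5 * (d * σ₁ ^ 2) * (1 - η * σd / 256) ^ t :=
  loss_le_lyapunov.trans
    ((Controlled.of_norm_sq_add_le h hp hr).lyapunov_iter_le h hp hA ht₁ t)

end Convergence

section SVD

variable {m n d : ℕ}

lemma transpose_mul_self_of_orthonormal {ι : Type*} [Fintype ι] {v : Fin d → EuclideanSpace ℝ ι}
    (hv : Orthonormal ℝ v) :
    (Matrix.of fun q i => v i q)ᵀ * (Matrix.of fun q i => v i q) = 1 := by
  ext i j
  have hij := orthonormal_iff_ite.mp hv j i
  simp only [PiLp.inner_apply, RCLike.inner_apply, conj_trivial] at hij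
  simp only [Matrix.mul_apply, Matrix.transpose_apply, Matrix.of_apply, hij, Matrix.one_apply,
    eq_comm]

lemma finrank_range_toEuclideanLin (S : Matrix (Fin m) (Fin n) ℝ) :
    Module.finrank ℝ (Matrix.toEuclideanLin S).range = S.rank := by
  rw [Matrix.rank_eq_finrank_range_toLin S (EuclideanSpace.basisFun (Fin m) ℝ).toBasis
    (EuclideanSpace.basisFun (Fin n) ℝ).toBasis, Matrix.toEuclideanLin_eq_toLin_orthonormal]

lemma sval_pos {S : Matrix (Fin m) (Fin n) ℝ} {i : ℕ} (hi : i < S.rank) : 0 < sval S i := by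
  rwa [sval, LinearMap.singularValues_pos_iff_lt_finrank_range, finrank_range_toEuclideanLin]

lemma sval_eq_zero {S : Matrix (Fin m) (Fin n) ℝ} {i : ℕ} (hi : S.rank ≤ i) : sval S i = 0 := by
  rwa [sval, LinearMap.singularValues_eq_zero_iff_le_finrank_range, finrank_range_toEuclideanLin]

lemma sval_antitone (S : Matrix (Fin m) (Fin n) ℝ) : Antitone (sval S) :=
  (Matrix.toEuclideanLin S).singularValues_antitone

/-- An orthonormal basis of right singular vectors of `S`, in the order of `sval S`. -/
def rightSingularBasis (S : Matrix (Fin m) (Fin n) ℝ) :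
    OrthonormalBasis (Fin n) ℝ (EuclideanSpace ℝ (Fin n)) :=
  (Matrix.toEuclideanLin S).isSymmetric_adjoint_comp_self.eigenvectorBasis
    finrank_euclideanSpace_fin

lemma inner_toEuclideanLin_rightSingularBasis (S : Matrix (Fin m) (Fin n) ℝ) (i j : Fin n) :
    inner ℝ (Matrix.toEuclideanLin S (rightSingularBasis S i))
      (Matrix.toEuclideanLin S (rightSingularBasis S j)) = if i = j then sval S i ^ 2 else 0 := by
  set T := Matrix.toEuclideanLin S
  have heigen := T.isSymmetric_adjoint_comp_self.apply_eigenvectorBasis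
    finrank_euclideanSpace_fin i
  rw [← LinearMap.adjoint_inner_left, ← LinearMap.comp_apply, rightSingularBasis, heigen,
    inner_smul_left, orthonormal_iff_ite.mp (OrthonormalBasis.orthonormal _), sval,
    T.sq_singularValues_fin finrank_euclideanSpace_fin]
  simp

lemma toEuclideanLin_rightSingularBasis_eq_zero {S : Matrix (Fin m) (Fin n) ℝ} {i : Fin n}
    (hi : S.rank ≤ i) : Matrix.toEuclideanLin S (rightSingularBasis S i) = 0 := by
  have hinner := inner_toEuclideanLin_rightSingularBasis S i i
  rwa [if_pos rfl, sval_eq_zero hi, zero_pow two_ne_zero, inner_self_eq_zero] at hinner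

lemma apply_eq_sum_rightSingularBasis (S : Matrix (Fin m) (Fin n) ℝ) (p : Fin m) (q : Fin n) :
    S p q = ∑ i, rightSingularBasis S i q *
      Matrix.toEuclideanLin S (rightSingularBasis S i) p := by
  have hexpand := congrArg (Matrix.toEuclideanLin S)
    ((rightSingularBasis S).sum_repr' (EuclideanSpace.single q (1 : ℝ)))
  have hSpq : S p q = Matrix.toEuclideanLin S (EuclideanSpace.single q 1) p := by
    simp [Matrix.toEuclideanLin]
  rw [hSpq, ← hexpand]
  simp [EuclideanSpace.inner_single_right]

lemma sum_castLE_rightSingularBasis {S : Matrix (Fin m) (Fin n) ℝ} (hd : S.rank ≤ d)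
    (hdn : d ≤ n) (p : Fin m) (q : Fin n) :
    ∑ i : Fin d, rightSingularBasis S (i.castLE hdn) q *
      Matrix.toEuclideanLin S (rightSingularBasis S (i.castLE hdn)) p = S p q := by
  rw [apply_eq_sum_rightSingularBasis S p q]
  refine Finset.sum_of_injOn (Fin.castLE hdn) (Fin.castLE_injective hdn).injOn
    (fun _ _ => Finset.mem_coe.mpr (Finset.mem_univ _)) (fun i _ hi => ?_) (fun _ _ => rfl)
  have hdi : d ≤ i := not_lt.mp fun hid => hi ⟨⟨i, hid⟩, by simp, rfl⟩
  simp [toEuclideanLin_rightSingularBasis_eq_zero (hd.trans hdi)]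

/-- The left singular vector of `S` attached to the `i`-th right singular vector; it is zero when
`sval S i = 0`. -/
def leftSingularVector (S : Matrix (Fin m) (Fin n) ℝ) (i : Fin n) : EuclideanSpace ℝ (Fin m) :=
  (sval S i)⁻¹ • Matrix.toEuclideanLin S (rightSingularBasis S i)

lemma orthonormal_leftSingularVector {S : Matrix (Fin m) (Fin n) ℝ} (hdn : d ≤ n)
    (hd : d ≤ S.rank) : Orthonormal ℝ fun i : Fin d => leftSingularVector S (i.castLE hdn) := by
  refine orthonormal_iff_ite.mpr fun i j => ?_
  have hpos : 0 < sval S j := sval_pos (j.isLt.trans_le hd)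
  simp only [leftSingularVector, inner_smul_left, inner_smul_right, conj_trivial,
    inner_toEuclideanLin_rightSingularBasis, (Fin.castLE_injective hdn).eq_iff, Fin.val_castLE]
  split_ifs with hij
  · subst hij
    field_simp
  · simp

theorem exists_isThinSVD (S : Matrix (Fin m) (Fin n) ℝ) (hd : 0 < d) (hS : S.rank = d) :
    ∃ (Φ : Matrix (Fin m) (Fin d) ℝ) (Ψ : Matrix (Fin n) (Fin d) ℝ) (σ : Fin d → ℝ),
      IsThinSVD S Φ Ψ σ (sval S 0) (sval S (d - 1)) := by
  have hdn : d ≤ n := hS ▸ S.rank_le_width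
  have hpos (i : Fin d) : 0 < sval S i := sval_pos (hS ▸ i.isLt)
  refine ⟨Matrix.of fun p i => leftSingularVector S (i.castLE hdn) p,
    Matrix.of fun q i => rightSingularBasis S (i.castLE hdn) q, fun i => sval S i,
    { ortho_left := transpose_mul_self_of_orthonormal (orthonormal_leftSingularVector hdn hS.ge)
      ortho_right := transpose_mul_self_of_orthonormal
        ((rightSingularBasis S).orthonormal.comp _ (Fin.castLE_injective hdn))
      eq_mul := ?_
      pos := sval_pos (by omega)
      lower := fun i => sval_antitone S (by omega)
      upper := fun i => sval_antitone S (Nat.zero_le _) }⟩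
  ext p q
  rw [← sum_castLE_rightSingularBasis hS.le hdn, Matrix.mul_apply]
  refine Finset.sum_congr rfl fun i _ => ?_
  have hi := (hpos i).ne'
  simp only [leftSingularVector, Matrix.mul_diagonal, Matrix.transpose_apply, Matrix.of_apply,
    PiLp.smul_apply, Fin.val_castLE, smul_eq_mul]
  field_simp

end SVD

section GaussianSlab

variable {ι : Type*} [Fintype ι] {v : ℝ≥0}

lemma gaussianReal_abs_lt_le (μ : ℝ) (hv : v ≠ 0) (τ : ℝ) :
    gaussianReal μ v {z | |z| < τ} ≤ ENNReal.ofReal (τ / √v) := by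
  have hset : {z : ℝ | |z| < τ} = Set.Ioo (-τ) τ := by
    ext z
    simp [abs_lt]
  have : 0 < √(v : ℝ) := Real.sqrt_pos.mpr (by positivity)
  have hsqrt : 2 * √v ≤ √(2 * Real.pi * v) := by
    refine Real.le_sqrt_of_sq_le ?_
    rw [mul_pow, Real.sq_sqrt v.coe_nonneg]
    nlinarith [Real.pi_gt_three, v.coe_nonneg]
  have hdensity (x : ℝ) : gaussianPDF μ v x ≤ ENNReal.ofReal ((2 * √v)⁻¹) := by
    refine ENNReal.ofReal_le_ofReal ?_
    have hexp : Real.exp (-(x - μ) ^ 2 / (2 * v)) ≤ 1 := by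
      rw [Real.exp_le_one_iff, neg_div]
      exact neg_nonpos.mpr (by positivity)
    calc _ ≤ (√(2 * Real.pi * v))⁻¹ * 1 := by rw [gaussianPDFReal]; gcongr
      _ ≤ _ := by rw [mul_one]; gcongr
  calc gaussianReal μ v {z | |z| < τ}
      = ∫⁻ x in Set.Ioo (-τ) τ, gaussianPDF μ v x := by rw [gaussianReal_apply _ hv, hset]
    _ ≤ ∫⁻ _ in Set.Ioo (-τ) τ, ENNReal.ofReal ((2 * √v)⁻¹) := lintegral_mono hdensity
    _ = ENNReal.ofReal (τ / √v) := by
        rw [setLIntegral_const, Real.volume_Ioo, ← ENNReal.ofReal_mul (by positivity)]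
        congr 1
        field_simp
        ring

lemma map_sum_mul_pi_gaussianReal (c : ι → ℝ) :
    (Measure.pi fun _ : ι => gaussianReal 0 v).map (fun x => ∑ i, c i * x i)
      = gaussianReal 0 ((∑ i, c i ^ 2).toNNReal * v) := by
  set P := Measure.pi fun _ : ι => gaussianReal 0 v
  have hcoord (i : ι) : HasGaussianLaw (fun x : ι → ℝ => x i) P :=
    ⟨by rw [(measurePreserving_eval _ i).map_eq]; infer_instance⟩
  have hjoint : HasGaussianLaw (fun x : ι → ℝ => x) P :=
    iIndepFun.hasGaussianLaw hcoord (iIndepFun_pi (X := fun _ x => x) fun _ => aemeasurable_id)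
  have hlaw : HasGaussianLaw (fun x : ι → ℝ => ∑ i, c i * x i) P := by
    simpa using hjoint.map_fun (∑ i, c i • ContinuousLinearMap.proj (R := ℝ) (φ := fun _ => ℝ) i)
  have hmean : ∫ x, ∑ i, c i * x i ∂P = 0 := by
    rw [integral_finsetSum _ fun i _ => (hcoord i).integrable.const_mul _]
    refine Finset.sum_eq_zero fun i _ => ?_
    have heval : ∫ x, x i ∂P = 0 := by
      rw [← integral_id_gaussianReal (μ := 0) (v := v)]
      exact integral_comp_eval (μ := fun _ : ι => gaussianReal 0 v) (f := fun y : ℝ => y)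
        aestronglyMeasurable_id
    rw [integral_const_mul, heval, mul_zero]
  have hvar : Var[fun x => ∑ i, c i * x i; P] = (∑ i, c i ^ 2) * v := by
    have hsum := variance_sum_pi (μ := fun _ : ι => gaussianReal 0 v) (X := fun i y => c i * y)
      fun i => (memLp_id_gaussianReal 2).const_mul (c i)
    have hfun : (∑ i, fun x : ι → ℝ => c i * x i) = fun x => ∑ i, c i * x i := by
      ext x
      simp
    rw [hfun] at hsum
    rw [hsum, Finset.sum_mul]
    refine Finset.sum_congr rfl fun i _ => ?_
    rw [variance_const_mul, variance_fun_id_gaussianReal]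
  rw [hlaw.map_eq_gaussianReal, hmean, hvar,
    Real.toNNReal_mul (Finset.sum_nonneg fun i _ => sq_nonneg _), Real.toNNReal_coe]

lemma pi_gaussianReal_abs_sum_lt_le (hv : v ≠ 0) {c : ι → ℝ} {b τ : ℝ} (hb : 0 < b) (hτ : 0 ≤ τ)
    (hc : b ^ 2 ≤ ∑ i, c i ^ 2) :
    Measure.pi (fun _ : ι => gaussianReal 0 v) {x | |∑ i, c i * x i| < τ}
      ≤ ENNReal.ofReal (τ / (b * √v)) := by
  have hsum : 0 < ∑ i, c i ^ 2 := (pow_pos hb 2).trans_le hc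
  have hmeas : MeasurableSet {z : ℝ | |z| < τ} := measurableSet_lt (by fun_prop) (by fun_prop)
  have : 0 < √(v : ℝ) := Real.sqrt_pos.mpr (by positivity)
  have hsqrt : b * √v ≤ √(((∑ i, c i ^ 2).toNNReal * v : ℝ≥0) : ℝ) := by
    rw [NNReal.coe_mul, Real.coe_toNNReal _ hsum.le, Real.sqrt_mul hsum.le]
    gcongr
    exact Real.le_sqrt_of_sq_le hc
  calc Measure.pi (fun _ : ι => gaussianReal 0 v) {x | |∑ i, c i * x i| < τ}
      = (Measure.pi fun _ : ι => gaussianReal 0 v).map (fun x => ∑ i, c i * x i)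
          {z | |z| < τ} := by
        rw [Measure.map_apply (by fun_prop) hmeas]
        rfl
    _ ≤ ENNReal.ofReal (τ / √(((∑ i, c i ^ 2).toNNReal * v : ℝ≥0) : ℝ)) := by
        rw [map_sum_mul_pi_gaussianReal]
        exact gaussianReal_abs_lt_le 0
          (mul_ne_zero (Real.toNNReal_pos.mpr hsum).ne' hv) τ
    _ ≤ ENNReal.ofReal (τ / (b * √v)) := by gcongr

end GaussianSlab

lemma pi_le_of_forall_updateFinset {ι : Type*} [Fintype ι] [DecidableEq ι] {X : ι → Type*}
    [∀ i, MeasurableSpace (X i)] (μ : ∀ i, Measure (X i)) [∀ i, IsProbabilityMeasure (μ i)]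
    (s : Finset ι) {E : Set (∀ i, X i)} (hE : MeasurableSet E) {β : ENNReal}
    (h : ∀ x, Measure.pi (fun i : s => μ i) {y | Function.updateFinset x s y ∈ E} ≤ β) :
    Measure.pi μ E ≤ β := by
  calc Measure.pi μ E = ∫⁻ x, E.indicator 1 x ∂Measure.pi μ := (lintegral_indicator_one hE).symm
    _ ≤ ∫⁻ _, β ∂Measure.pi μ := by
        refine lintegral_le_of_lmarginal_le s (measurable_one.indicator hE) measurable_const
          fun x => ?_
        have hslice : MeasurableSet {y : ∀ i : s, X i | Function.updateFinset x s y ∈ E} :=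
          measurable_updateFinset hE
        calc lmarginal μ s (E.indicator 1) x
            = Measure.pi (fun i : s => μ i) {y | Function.updateFinset x s y ∈ E} :=
              lintegral_indicator_one hslice
          _ ≤ lmarginal μ s (fun _ => β) x := by simpa [lmarginal] using h x
    _ = β := by simp

section NearlyDependent

variable {ι κ : Type*} [Fintype ι] [Fintype κ] {M : Matrix ι κ ℝ} {τ : ℝ}

/-- The arrays `x`, read as matrices `X`, for which the `j`-th column of `M X` is at distance less
than `τ` from the span of the other columns. The set is open, hence measurable. -/
def nearlyDependent (M : Matrix ι κ ℝ) (τ : ℝ) (j : ι) : Set (κ × ι → ℝ) :=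
  {x | ∃ y : Matrix ι Unit ℝ, y j () = 1 ∧ ‖M * Matrix.of (Function.curry x) * y‖ < τ}

lemma isOpen_nearlyDependent (M : Matrix ι κ ℝ) (τ : ℝ) (j : ι) :
    IsOpen (nearlyDependent M τ j) := by
  have hset : nearlyDependent M τ j = ⋃ (y : Matrix ι Unit ℝ) (_ : y j () = 1),
      {x | ‖M * Matrix.of (Function.curry x) * y‖ < τ} := by
    ext x
    simp [nearlyDependent]
  rw [hset]
  refine isOpen_iUnion fun y => isOpen_iUnion fun _ => isOpen_lt ?_ continuous_const
  refine Continuous.norm (Continuous.matrix_mul (continuous_const.matrix_mul ?_) continuous_const)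
  exact continuous_matrix fun q i => continuous_apply (q, i)

lemma boundedBelow_of_forall_notMem_nearlyDependent (hτ : 0 ≤ τ) {x : κ × ι → ℝ}
    (hx : ∀ j, x ∉ nearlyDependent M τ j) :
    BoundedBelow (M * Matrix.of (Function.curry x)) (τ / √(Fintype.card ι)) := fun y => by
  set A := M * Matrix.of (Function.curry x)
  have hcoord (j : ι) : τ * |y j ()| ≤ ‖A * y‖ := by
    rcases eq_or_ne (y j ()) 0 with hy | hy
    · simp [hy]
    have hscaled : τ ≤ ‖A * ((y j ())⁻¹ • y)‖ :=
      not_lt.mp fun hlt => hx j ⟨_, by simp [hy], hlt⟩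
    rw [Matrix.mul_smul, norm_smul, norm_inv, Real.norm_eq_abs] at hscaled
    exact (le_inv_mul_iff₀' (abs_pos.mpr hy)).mp hscaled
  have hsum : τ ^ 2 * ‖y‖ ^ 2 ≤ ‖A * y‖ ^ 2 * Fintype.card ι :=
    calc τ ^ 2 * ‖y‖ ^ 2 = ∑ j, (τ * |y j ()|) ^ 2 := by
          simp [frobenius_norm_sq_eq_sum, mul_pow, Finset.mul_sum]
      _ ≤ ∑ _j : ι, ‖A * y‖ ^ 2 :=
          Finset.sum_le_sum fun j _ => pow_le_pow_left₀ (by positivity) (hcoord j) 2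
      _ = ‖A * y‖ ^ 2 * Fintype.card ι := by simp [mul_comm]
  refine le_of_sq_le_sq ?_ (norm_nonneg _)
  rw [mul_pow, div_pow, Real.sq_sqrt (Nat.cast_nonneg _), div_mul_eq_mul_div]
  exact div_le_of_le_mul₀ (Nat.cast_nonneg _) (sq_nonneg _) hsum

lemma exists_norm_eq_one_transpose_mul_apply_eq_zero (A : Matrix ι ι ℝ) (j : ι) :
    ∃ w : Matrix ι Unit ℝ, ‖w‖ = 1 ∧ ∀ i ≠ j, (Aᵀ * w) i () = 0 := by
  classical
  obtain ⟨u, hu, huA⟩ : ∃ u : ι → ℝ, u ≠ 0 ∧ u ᵥ* A.updateCol j 0 = 0 :=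
    Matrix.exists_vecMul_eq_zero_iff.mpr (Matrix.det_eq_zero_of_column_eq_zero j fun i => by simp)
  have hw : Matrix.replicateCol Unit u ≠ 0 := by simpa using hu
  set w := Matrix.replicateCol Unit u
  have hnorm : ‖‖w‖⁻¹ • w‖ = 1 := by
    rw [norm_smul, norm_inv, norm_norm, inv_mul_cancel₀ (norm_ne_zero_iff.mpr hw)]
  refine ⟨‖w‖⁻¹ • w, hnorm, fun i hi => ?_⟩
  have hcol : ∑ k, A k i * u k = 0 := by
    simpa [Matrix.vecMul, dotProduct, Matrix.updateCol_ne hi, mul_comm] using congrFun huA i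
  have hortho : (Aᵀ * w) i () = 0 := by rwa [Matrix.mul_apply]
  rw [Matrix.mul_smul, Matrix.smul_apply, hortho, smul_zero]

-- A unit normal `w` of the other columns depends only on those, and turns near dependence of the
-- `j`-th column into a slab for the `j`-th column of the array.
lemma exists_abs_sum_lt_of_mem_nearlyDependent {b : ℝ} (hM : BoundedBelow Mᵀ b)
    (hb : 0 ≤ b) (j : ι) (x₀ : κ × ι → ℝ) :
    ∃ c : κ → ℝ, b ^ 2 ≤ ∑ q, c q ^ 2 ∧ ∀ x ∈ nearlyDependent M τ j,
      (∀ q, ∀ i ≠ j, x (q, i) = x₀ (q, i)) → |∑ q, c q * x (q, j)| < τ := by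
  obtain ⟨w, hw, hwx₀⟩ := exists_norm_eq_one_transpose_mul_apply_eq_zero
    (M * Matrix.of (Function.curry x₀)) j
  have hnormal (x : κ × ι → ℝ) (i : ι) :
      ((M * Matrix.of (Function.curry x))ᵀ * w) i () = ∑ q, (Mᵀ * w) q () * x (q, i) := by
    rw [Matrix.transpose_mul, Matrix.mul_assoc, Matrix.mul_apply]
    exact Finset.sum_congr rfl fun q _ => mul_comm _ _
  refine ⟨fun q => (Mᵀ * w) q (), ?_, ?_⟩
  · have hMw := hM w
    rw [hw, mul_one] at hMw
    simpa [frobenius_norm_sq_eq_sum] using pow_le_pow_left₀ hb hMw 2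
  · rintro x ⟨y, hy, hxy⟩ hxx₀
    set A := M * Matrix.of (Function.curry x)
    have hvanish (i : ι) (hi : i ≠ j) : (Aᵀ * w) i () = 0 := by
      rw [hnormal, ← hwx₀ i hi, hnormal]
      exact Finset.sum_congr rfl fun q _ => by rw [hxx₀ q i hi]
    have hinner : ⟪w, A * y⟫_ℝ = (Aᵀ * w) j () := by
      have hsum : ⟪y, Aᵀ * w⟫_ℝ = ∑ i, y i () * (Aᵀ * w) i () := by
        simp [inner_eq_trace, Matrix.trace, Matrix.mul_apply]
      rw [real_inner_comm, inner_mul_left_eq, hsum,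
        Fintype.sum_eq_single j fun i hi => by rw [hvanish i hi, mul_zero], hy, one_mul]
    rw [← hnormal, ← hinner]
    calc |⟪w, A * y⟫_ℝ| ≤ ‖w‖ * ‖A * y‖ := abs_real_inner_le_norm _ _
      _ < τ := by rwa [hw, one_mul]

lemma pi_gaussianReal_nearlyDependent_le {v : ℝ≥0} (hv : v ≠ 0) {b : ℝ}
    (hM : BoundedBelow Mᵀ b) (hb : 0 < b) (hτ : 0 ≤ τ) (j : ι) :
    Measure.pi (fun _ : κ × ι => gaussianReal 0 v) (nearlyDependent M τ j)
      ≤ ENNReal.ofReal (τ / (b * √v)) := by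
  classical
  set s : Finset (κ × ι) := Finset.univ ×ˢ {j}
  refine pi_le_of_forall_updateFinset _ s (isOpen_nearlyDependent M τ j).measurableSet fun x₀ => ?_
  obtain ⟨c, hbc, hslab⟩ := exists_abs_sum_lt_of_mem_nearlyDependent (τ := τ) hM hb.le j x₀
  have hsum (f : κ × ι → ℝ) : ∑ i : s, f i = ∑ q, f (q, j) := by
    rw [Finset.sum_coe_sort s f, Finset.sum_product]
    simp
  refine (measure_mono fun y hy => ?_).trans
    (pi_gaussianReal_abs_sum_lt_le hv (c := fun i : s => c i.1.1) hb hτ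
      (hbc.trans_eq (hsum fun i => c i.1 ^ 2).symm))
  have hcolumn := hslab _ hy fun q i hi => by simp [Function.updateFinset, s, hi.symm]
  rw [← hsum fun i => c i.1 * Function.updateFinset x₀ s y i] at hcolumn
  simpa [Function.updateFinset] using hcolumn

end NearlyDependent

section Initialization

lemma measurePreserving_uncurry_sumElim {α β γ X : Type*} [Fintype α] [Fintype β] [Fintype γ]
    [MeasurableSpace X] (μ : Measure X) [SigmaFinite μ] :
    MeasurePreserving (fun W : (α → γ → X) × (β → γ → X) => Function.uncurry (Sum.elim W.1 W.2))
      ((Measure.pi fun _ => Measure.pi fun _ => μ).prod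
        (Measure.pi fun _ => Measure.pi fun _ => μ))
      (Measure.pi fun _ => μ) := by
  have hmeas : Measurable
      fun W : (α → γ → X) × (β → γ → X) => Function.uncurry (Sum.elim W.1 W.2) := by
    refine measurable_pi_iff.mpr ?_
    rintro ⟨i | i, j⟩ <;> simp only [Function.uncurry, Sum.elim_inl, Sum.elim_inr] <;> fun_prop
  refine ⟨hmeas, (Measure.pi_eq fun s hs => ?_).symm⟩
  have hpre : (fun W : (α → γ → X) × (β → γ → X) => Function.uncurry (Sum.elim W.1 W.2)) ⁻¹'
        Set.univ.pi s
      = (Set.univ.pi fun i => Set.univ.pi fun j => s (Sum.inl i, j)) ×ˢ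
        (Set.univ.pi fun i => Set.univ.pi fun j => s (Sum.inr i, j)) := by
    ext W
    simp [Function.uncurry]
  rw [Measure.map_apply hmeas (MeasurableSet.univ_pi hs), hpre, Measure.prod_prod]
  simp only [Measure.pi_pi, Fintype.prod_prod_type, Fintype.prod_sum_type]

lemma lintegral_sq_gaussianReal (v : ℝ≥0) :
    ∫⁻ x, ENNReal.ofReal (x ^ 2) ∂(gaussianReal 0 v) = v := by
  have hvar := (memLp_id_gaussianReal (μ := 0) (v := v) 2).ofReal_variance_eq
  rw [variance_id_gaussianReal, ENNReal.ofReal_coe_nnreal, evariance_eq_lintegral_ofReal] at hvar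
  simpa using hvar.symm

lemma pi_gaussianReal_le_sum_sq_le {ι : Type*} [Fintype ι] (v : ℝ≥0) {R : ℝ} (hR : 0 < R) :
    Measure.pi (fun _ : ι => gaussianReal 0 v) {x | R ≤ ∑ i, x i ^ 2}
      ≤ ENNReal.ofReal (Fintype.card ι * v / R) := by
  have hmean : ∫⁻ x, ENNReal.ofReal (∑ i, x i ^ 2) ∂(Measure.pi fun _ : ι => gaussianReal 0 v)
      = Fintype.card ι * v := by
    simp only [ENNReal.ofReal_sum_of_nonneg fun _ _ => sq_nonneg _]
    rw [lintegral_finsetSum _ fun _ _ => by fun_prop]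
    have hcoord (i : ι) :
        ∫⁻ x, ENNReal.ofReal (x i ^ 2) ∂(Measure.pi fun _ : ι => gaussianReal 0 v) = v := by
      rw [← lintegral_sq_gaussianReal]
      exact (measurePreserving_eval (fun _ : ι => gaussianReal 0 v) i).lintegral_comp
        (f := fun x => ENNReal.ofReal (x ^ 2)) (by fun_prop)
    simp [hcoord]
  calc Measure.pi (fun _ : ι => gaussianReal 0 v) {x | R ≤ ∑ i, x i ^ 2}
      ≤ Measure.pi (fun _ : ι => gaussianReal 0 v)
          {x | ENNReal.ofReal R ≤ ENNReal.ofReal (∑ i, x i ^ 2)} :=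
        measure_mono fun x hx => ENNReal.ofReal_le_ofReal hx
    _ ≤ Fintype.card ι * v / ENNReal.ofReal R := by
        rw [← hmean]
        exact meas_ge_le_lintegral_div (Measurable.aemeasurable (by fun_prop)) (by simpa using hR)
          ENNReal.ofReal_ne_top
    _ = ENNReal.ofReal (Fintype.card ι * v / R) := by
        rw [ENNReal.ofReal_div_of_pos hR, ENNReal.ofReal_mul (Nat.cast_nonneg _),
          ENNReal.ofReal_natCast, ENNReal.ofReal_coe_nnreal]

variable {m n d : ℕ}

lemma boundedBelow_transpose_half_smul_fromCols {Φ : Matrix (Fin m) (Fin d) ℝ} (hΦ : Φᵀ * Φ = 1)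
    (Ψ : Matrix (Fin n) (Fin d) ℝ) :
    BoundedBelow ((1 / 2 : ℝ) • Matrix.fromCols Φᵀ Ψᵀ)ᵀ (1 / 2) := fun w => by
  rw [Matrix.transpose_smul, Matrix.smul_mul, norm_smul, Real.norm_of_nonneg (by norm_num),
    Matrix.transpose_fromCols, Matrix.transpose_transpose, Matrix.transpose_transpose,
    Matrix.fromRows_mul]
  gcongr
  rw [← norm_mul_eq_of_transpose_mul_self hΦ w]
  refine le_of_sq_le_sq ?_ (norm_nonneg _)
  rw [frobenius_norm_sq_eq_sum, frobenius_norm_sq_eq_sum, Fintype.sum_sum_type]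
  exact le_add_of_nonneg_right (Finset.sum_nonneg fun i _ => Finset.sum_nonneg fun j _ =>
    sq_nonneg _)

lemma half_smul_fromCols_mul_sumElim (Φ : Matrix (Fin m) (Fin d) ℝ) (Ψ : Matrix (Fin n) (Fin d) ℝ)
    (W : (Fin m → Fin d → ℝ) × (Fin n → Fin d → ℝ)) :
    (1 / 2 : ℝ) • Matrix.fromCols Φᵀ Ψᵀ * Matrix.of (Sum.elim W.1 W.2)
      = halfSum Φ Ψ (Matrix.of W.1, Matrix.of W.2) := by
  rw [halfSum, Matrix.smul_mul]
  congr 1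
  exact Matrix.fromCols_mul_fromRows Φᵀ Ψᵀ (Matrix.of W.1) (Matrix.of W.2)

lemma sum_uncurry_sumElim_sq (W : (Fin m → Fin d → ℝ) × (Fin n → Fin d → ℝ)) :
    ∑ z, Function.uncurry (Sum.elim W.1 W.2) z ^ 2
      = ‖(Matrix.of W.1 : Matrix (Fin m) (Fin d) ℝ)‖ ^ 2
        + ‖(Matrix.of W.2 : Matrix (Fin n) (Fin d) ℝ)‖ ^ 2 := by
  simp [frobenius_norm_sq_eq_sum, Fintype.sum_prod_type, Function.uncurry]

lemma pi_gaussianReal_large_or_nearlyDependent_le {ι κ : Type*} [Fintype ι] [Fintype κ] {v : ℝ≥0}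
    (hv : v ≠ 0) {M : Matrix ι κ ℝ} {b : ℝ} (hM : BoundedBelow Mᵀ b) (hb : 0 < b) {R τ : ℝ}
    (hR : 0 < R) (hτ : 0 ≤ τ) :
    Measure.pi (fun _ : κ × ι => gaussianReal 0 v)
        ({x | R ≤ ∑ z, x z ^ 2} ∪ ⋃ j, nearlyDependent M τ j)
      ≤ ENNReal.ofReal (Fintype.card (κ × ι) * v / R + Fintype.card ι * (τ / (b * √v))) := by
  rw [ENNReal.ofReal_add (by positivity) (by positivity),
    ENNReal.ofReal_mul (p := (Fintype.card ι : ℝ)) (Nat.cast_nonneg _), ENNReal.ofReal_natCast]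
  refine (measure_union_le _ _).trans
    (add_le_add (pi_gaussianReal_le_sum_sq_le v hR) ((measure_iUnion_fintype_le _ _).trans ?_))
  simpa using Finset.sum_le_sum fun j (_ : j ∈ Finset.univ) =>
    pi_gaussianReal_nearlyDependent_le hv hM hb hτ j

theorem le_gaussianInit_norm_sq_le_and_boundedBelow {Φ : Matrix (Fin m) (Fin d) ℝ}
    (hΦ : Φᵀ * Φ = 1) (Ψ : Matrix (Fin n) (Fin d) ℝ) {ε R τ : ℝ} (hε : 0 < ε) (hR : 0 < R)
    (hτ : 0 ≤ τ) :
    ENNReal.ofReal (1 - (((m : ℝ) + n) * d * ε ^ 2 / R + d * (2 * τ / ε)))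
      ≤ gaussianInit m n d ε
        {W | ‖(Matrix.of W.1 : Matrix (Fin m) (Fin d) ℝ)‖ ^ 2
            + ‖(Matrix.of W.2 : Matrix (Fin n) (Fin d) ℝ)‖ ^ 2 ≤ R ∧
          BoundedBelow (halfSum Φ Ψ (Matrix.of W.1, Matrix.of W.2)) (τ / √d)} := by
  set M := (1 / 2 : ℝ) • Matrix.fromCols Φᵀ Ψᵀ
  set v := Real.toNNReal (ε ^ 2)
  have hv : (v : ℝ) = ε ^ 2 := Real.coe_toNNReal _ (sq_nonneg ε)
  have hv₀ : v ≠ 0 := (Real.toNNReal_pos.mpr (by positivity)).ne'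
  set bad : Set ((Fin m ⊕ Fin n) × Fin d → ℝ) :=
    {x | R ≤ ∑ z, x z ^ 2} ∪ ⋃ j, nearlyDependent M τ j
  have hbad : MeasurableSet bad :=
    (measurableSet_le measurable_const (by fun_prop)).union
      (MeasurableSet.iUnion fun j => (isOpen_nearlyDependent M τ j).measurableSet)
  have hprob := pi_gaussianReal_large_or_nearlyDependent_le hv₀
    (boundedBelow_transpose_half_smul_fromCols hΦ Ψ) (by norm_num) hR hτ
  rw [hv, Real.sqrt_sq hε.le, Fintype.card_prod, Fintype.card_sum, Fintype.card_fin,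
    Fintype.card_fin, Fintype.card_fin, Nat.cast_mul, Nat.cast_add,
    show τ / (1 / 2 * ε) = 2 * τ / ε by field_simp] at hprob
  calc ENNReal.ofReal (1 - (((m : ℝ) + n) * d * ε ^ 2 / R + d * (2 * τ / ε)))
      ≤ Measure.pi (fun _ => gaussianReal 0 v) badᶜ := by
        rw [prob_compl_eq_one_sub hbad, ENNReal.ofReal_sub _ (by positivity), ENNReal.ofReal_one]
        exact tsub_le_tsub_left hprob _
    _ = gaussianInit m n d ε {W | Function.uncurry (Sum.elim W.1 W.2) ∈ badᶜ} :=
        ((measurePreserving_uncurry_sumElim _).measure_preimage hbad.compl.nullMeasurableSet).symm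
    _ ≤ _ := measure_mono fun W hW => ?_
  obtain ⟨hsmall, hindep⟩ := not_or.mp hW
  constructor
  · rw [← sum_uncurry_sumElim_sq]
    exact (not_le.mp hsmall).le
  · rw [← half_smul_fromCols_mul_sumElim]
    simpa only [Function.curry_uncurry, Fintype.card_fin] using
      boundedBelow_of_forall_notMem_nearlyDependent hτ
      fun j hj => hindep (Set.mem_iUnion.mpr ⟨j, hj⟩)

end Initialization

section Scales

/-- The scales of the theorem: failure probability `ρ`, rank `d`, total dimension `N = m + n`,
extreme singular values `σ₁` and `σd`, and standard deviation `ε` of the initialization. The last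
field is the square of the smallness assumption on `ε`. -/
structure InitScale (d : ℕ) (N σ₁ σd ε ρ : ℝ) : Prop where
  ρ_pos : 0 < ρ
  ρ_le_one : ρ ≤ 1
  one_le_d : 1 ≤ (d : ℝ)
  d_le : (d : ℝ) ≤ N
  σd_pos : 0 < σd
  σd_le : σd ≤ σ₁
  ε_pos : 0 < ε
  scale_le : 10 ^ 6 * (ε ^ 2 * (d ^ 3 * N ^ 2) * σ₁) ≤ ρ ^ 4 * σd ^ 2

/-- A bound on the norm of the initialization that fails with probability at most `ρ / 2`. -/
def initRadius (d : ℕ) (N ε ρ : ℝ) : ℝ := √(2 * (N * d * ε ^ 2) / ρ)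

/-- A lower bound on the singular values of the initial half sum that fails with probability at
most `ρ / 2`. -/
def initFloor (d : ℕ) (ε ρ : ℝ) : ℝ := ρ * ε / (4 * d) / √d

namespace InitScale

variable {d : ℕ} {N σ₁ σd ε ρ η : ℝ}

lemma d_pos (h : InitScale d N σ₁ σd ε ρ) : 0 < (d : ℝ) := zero_lt_one.trans_le h.one_le_d

lemma one_le_N (h : InitScale d N σ₁ σd ε ρ) : 1 ≤ N := h.one_le_d.trans h.d_le

lemma N_pos (h : InitScale d N σ₁ σd ε ρ) : 0 < N := zero_lt_one.trans_le h.one_le_N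

lemma σ₁_pos (h : InitScale d N σ₁ σd ε ρ) : 0 < σ₁ := h.σd_pos.trans_le h.σd_le

lemma pow_mul_pow_le (h : InitScale d N σ₁ σd ε ρ) {a b : ℕ} (ha : a ≤ 3) (hb : b ≤ 2) :
    (d : ℝ) ^ a * N ^ b ≤ d ^ 3 * N ^ 2 := by
  have hd := h.d_pos
  have hN := h.N_pos
  gcongr
  · exact h.one_le_d
  · exact h.one_le_N

lemma ε_sq_mul_σ₁_le (h : InitScale d N σ₁ σd ε ρ) (a b k : ℕ)
    (ha : a ≤ 3 := by norm_num) (hb : b ≤ 2 := by norm_num) (hk : k ≤ 4 := by norm_num) :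
    10 ^ 6 * (ε ^ 2 * (d ^ a * N ^ b) * σ₁) ≤ ρ ^ k * σd ^ 2 := by
  have hσ₁ := h.σ₁_pos
  calc 10 ^ 6 * (ε ^ 2 * (d ^ a * N ^ b) * σ₁)
      ≤ 10 ^ 6 * (ε ^ 2 * (d ^ 3 * N ^ 2) * σ₁) := by
        gcongr 10 ^ 6 * (ε ^ 2 * ?_ * σ₁)
        exact h.pow_mul_pow_le ha hb
    _ ≤ ρ ^ 4 * σd ^ 2 := h.scale_le
    _ ≤ ρ ^ k * σd ^ 2 :=
        mul_le_mul_of_nonneg_right (pow_le_pow_of_le_one h.ρ_pos.le h.ρ_le_one hk) (sq_nonneg σd)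

lemma ε_sq_le (h : InitScale d N σ₁ σd ε ρ) (a b k : ℕ)
    (ha : a ≤ 3 := by norm_num) (hb : b ≤ 2 := by norm_num) (hk : k ≤ 4 := by norm_num) :
    10 ^ 6 * (ε ^ 2 * (d ^ a * N ^ b)) ≤ ρ ^ k * σd := by
  have hd := h.d_pos
  have hN := h.N_pos
  refine le_of_mul_le_mul_right ?_ h.σd_pos
  calc 10 ^ 6 * (ε ^ 2 * (d ^ a * N ^ b)) * σd ≤ 10 ^ 6 * (ε ^ 2 * (d ^ a * N ^ b)) * σ₁ := by
        gcongr
        exact h.σd_le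
    _ ≤ ρ ^ k * σd ^ 2 := by linarith [h.ε_sq_mul_σ₁_le a b k ha hb hk]
    _ = ρ ^ k * σd * σd := by ring

lemma initRadius_sq (h : InitScale d N σ₁ σd ε ρ) :
    initRadius d N ε ρ ^ 2 = 2 * (N * d * ε ^ 2) / ρ := by
  have hN := h.N_pos
  have hρ := h.ρ_pos
  exact Real.sq_sqrt (by positivity)

lemma initFloor_pos (h : InitScale d N σ₁ σd ε ρ) : 0 < initFloor d ε ρ := by
  have hd := h.d_pos
  have hρ := h.ρ_pos
  have hε := h.ε_pos
  rw [initFloor]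
  positivity

lemma initFloor_sq : initFloor d ε ρ ^ 2 = ρ ^ 2 * ε ^ 2 / (16 * d ^ 3) := by
  rw [initFloor, div_pow, div_pow, mul_pow, mul_pow, Real.sq_sqrt d.cast_nonneg, div_div]
  ring

lemma initRadius_sq_le (h : InitScale d N σ₁ σd ε ρ) : 1000 * initRadius d N ε ρ ^ 2 ≤ σd := by
  rw [h.initRadius_sq, mul_div_assoc', div_le_iff₀ h.ρ_pos]
  have := h.ε_sq_le 1 1 1
  linarith [mul_pos h.σd_pos h.ρ_pos]

lemma sqrt_mul_initRadius_le (h : InitScale d N σ₁ σd ε ρ) :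
    3 * (√(5 * (d * σ₁)) * initRadius d N ε ρ) ≤ σd := by
  have hσ₁ := h.σ₁_pos
  refine le_of_sq_le_sq ?_ h.σd_pos.le
  rw [mul_pow, mul_pow, Real.sq_sqrt (by positivity), h.initRadius_sq]
  calc 3 ^ 2 * (5 * (d * σ₁) * (2 * (N * d * ε ^ 2) / ρ))
      = 90 * (ε ^ 2 * (d ^ 2 * N ^ 1) * σ₁) / ρ := by ring
    _ ≤ σd ^ 2 := by
        rw [div_le_iff₀ h.ρ_pos]
        have := h.ε_sq_mul_σ₁_le 2 1 1
        linarith [mul_nonneg h.ρ_pos.le (sq_nonneg σd)]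

lemma initRadius_cube_le (h : InitScale d N σ₁ σd ε ρ) :
    12 * initRadius d N ε ρ ^ 3 ≤ σd * initFloor d ε ρ := by
  have hd := h.d_pos
  have hN := h.N_pos
  have hρ := h.ρ_pos
  have hσd := h.σd_pos
  refine le_of_sq_le_sq ?_ (mul_pos hσd h.initFloor_pos).le
  have hsq : (10 ^ 6 * (ε ^ 2 * (d ^ 3 * N ^ 2))) ^ 2 ≤ (ρ ^ 4 * σd) ^ 2 := by
    gcongr ?_ ^ 2
    exact h.ε_sq_le 3 2 4
  calc (12 * initRadius d N ε ρ ^ 3) ^ 2 = 144 * (initRadius d N ε ρ ^ 2) ^ 3 := by ring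
    _ = 18432 * (ε ^ 4 * (d ^ 6 * N ^ 3)) * (ε ^ 2 / (16 * d ^ 3 * ρ ^ 3)) := by
        rw [h.initRadius_sq]
        field_simp
        ring
    _ ≤ 10 ^ 12 * (ε ^ 4 * (d ^ 6 * N ^ 4)) * (ε ^ 2 / (16 * d ^ 3 * ρ ^ 3)) := by
        gcongr ?_ * (ε ^ 4 * (d ^ 6 * ?_)) * _
        · norm_num
        · exact pow_le_pow_right₀ h.one_le_N (by norm_num)
    _ ≤ (ρ ^ 5 * σd ^ 2) * (ε ^ 2 / (16 * d ^ 3 * ρ ^ 3)) := by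
        gcongr ?_ * _
        calc 10 ^ 12 * (ε ^ 4 * (d ^ 6 * N ^ 4)) ≤ ρ ^ 8 * σd ^ 2 := by linarith
          _ ≤ ρ ^ 5 * σd ^ 2 := mul_le_mul_of_nonneg_right
              (pow_le_pow_of_le_one hρ.le h.ρ_le_one (by norm_num)) (sq_nonneg σd)
    _ = (σd * initFloor d ε ρ) ^ 2 := by
        rw [mul_pow, initFloor_sq]
        field_simp

lemma initFloor_sq_le (h : InitScale d N σ₁ σd ε ρ) : 16 * initFloor d ε ρ ^ 2 ≤ σd := by
  have hd := h.d_pos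
  have hε := h.ε_sq_le 0 0 0
  calc 16 * initFloor d ε ρ ^ 2 = ρ ^ 2 * ε ^ 2 / d ^ 3 := by
        rw [initFloor_sq]
        field_simp
    _ ≤ 1 ^ 2 * ε ^ 2 / 1 ^ 3 := by
        have hρ := h.ρ_pos
        gcongr
        · exact h.ρ_le_one
        · exact h.one_le_d
    _ ≤ σd := by linarith [h.σd_pos]

lemma step_growth (h : InitScale d N σ₁ σd ε ρ) (hη : 0 < η)
    (hηle : η * (d * σ₁ ^ 3) ≤ 1 / 2 * (σd * ε ^ 2)) :
    40 * (η * (σ₁ * √(5 * (d * σ₁)) ^ 3)) ≤ σd * initFloor d ε ρ := by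
  have hd := h.d_pos
  have hσ₁ := h.σ₁_pos
  have hscale : 10 ^ 6 * (ε ^ 2 * d ^ 4) ≤ ρ ^ 2 * σ₁ :=
    calc 10 ^ 6 * (ε ^ 2 * d ^ 4) ≤ 10 ^ 6 * (ε ^ 2 * (d ^ 3 * N ^ 1)) := by
          rw [pow_one, pow_succ (d : ℝ) 3]
          gcongr
          exact h.d_le
      _ ≤ ρ ^ 2 * σd := h.ε_sq_le 3 1 2
      _ ≤ ρ ^ 2 * σ₁ := by
          gcongr
          exact h.σd_le
  refine le_of_sq_le_sq ?_ (mul_pos h.σd_pos h.initFloor_pos).le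
  calc (40 * (η * (σ₁ * √(5 * (d * σ₁)) ^ 3))) ^ 2
      = 1600 * (η * σ₁) ^ 2 * (√(5 * (d * σ₁)) ^ 2) ^ 3 := by ring
    _ = 200000 * (η * (d * σ₁ ^ 3)) ^ 2 * (d / σ₁) := by
        rw [Real.sq_sqrt (by positivity)]
        field_simp
        ring
    _ ≤ 200000 * (1 / 2 * (σd * ε ^ 2)) ^ 2 * (d / σ₁) := by gcongr
    _ = 50000 * (ε ^ 2 * d ^ 4) * (σd ^ 2 * ε ^ 2 / (d ^ 3 * σ₁)) := by
        field_simp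
        ring
    _ ≤ ρ ^ 2 * σ₁ / 16 * (σd ^ 2 * ε ^ 2 / (d ^ 3 * σ₁)) := by
        gcongr
        linarith [mul_nonneg (sq_nonneg ε) (pow_nonneg hd.le 4)]
    _ = (σd * initFloor d ε ρ) ^ 2 := by
        rw [mul_pow, initFloor_sq]
        field_simp

lemma step_drift (h : InitScale d N σ₁ σd ε ρ)
    (hηle : η * (d * σ₁ ^ 3) ≤ 1 / 2 * (σd * ε ^ 2)) :
    4 * (η * (d * σ₁ ^ 2)) ≤ initRadius d N ε ρ ^ 2 := by
  have hσ₁ := h.σ₁_pos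
  have hstep : η * (d * σ₁ ^ 2) ≤ 1 / 2 * ε ^ 2 := by
    refine le_of_mul_le_mul_right ?_ hσ₁
    calc η * (d * σ₁ ^ 2) * σ₁ = η * (d * σ₁ ^ 3) := by ring
      _ ≤ 1 / 2 * (σd * ε ^ 2) := hηle
      _ ≤ 1 / 2 * (σ₁ * ε ^ 2) := by
          gcongr
          exact h.σd_le
      _ = 1 / 2 * ε ^ 2 * σ₁ := by ring
  have hε : ε ^ 2 ≤ N * d * ε ^ 2 :=
    le_mul_of_one_le_left (sq_nonneg ε) (one_le_mul_of_one_le_of_one_le h.one_le_N h.one_le_d)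
  rw [h.initRadius_sq]
  calc 4 * (η * (d * σ₁ ^ 2)) ≤ 2 * (N * d * ε ^ 2) := by linarith
    _ ≤ 2 * (N * d * ε ^ 2) / ρ := le_div_self (by linarith [sq_nonneg ε]) h.ρ_pos h.ρ_le_one

lemma step_smooth (h : InitScale d N σ₁ σd ε ρ)
    (hηle : η * (d * σ₁ ^ 3) ≤ 1 / 2 * (σd * ε ^ 2)) :
    8 * (η * (√(5 * (d * σ₁)) ^ 2) ^ 2) ≤ σd := by
  have hσ₁ := h.σ₁_pos
  have hσd := h.σd_pos
  have hε := h.ε_sq_le 1 0 0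
  rw [Real.sq_sqrt (by positivity)]
  refine le_of_mul_le_mul_right ?_ hσ₁
  calc 8 * (η * (5 * (d * σ₁)) ^ 2) * σ₁ = 200 * d * (η * (d * σ₁ ^ 3)) := by ring
    _ ≤ 200 * d * (1 / 2 * (σd * ε ^ 2)) := by gcongr
    _ = σd * (100 * (ε ^ 2 * (d ^ 1 * N ^ 0))) := by ring
    _ ≤ σd * σ₁ := by
        gcongr
        linarith [h.σd_le]

theorem smallParams (h : InitScale d N σ₁ σd ε ρ) (hη : 0 < η)
    (hηle : η * (d * σ₁ ^ 3) ≤ 1 / 2 * (σd * ε ^ 2)) :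
    SmallParams d σ₁ σd η (initRadius d N ε ρ) (initFloor d ε ρ) √(5 * (d * σ₁)) where
  step_pos := hη
  r_nonneg := Real.sqrt_nonneg _
  s_pos := h.initFloor_pos
  σd_pos := h.σd_pos
  σd_le := h.σd_le
  one_le_d := h.one_le_d
  l_nonneg := Real.sqrt_nonneg _
  l_sq := Real.sq_sqrt (mul_nonneg (by norm_num) (mul_pos h.d_pos h.σ₁_pos).le)
  r_sq_le := h.initRadius_sq_le
  l_mul_r_le := h.sqrt_mul_initRadius_le
  r_cube_le := h.initRadius_cube_le
  step_growth := h.step_growth hη hηle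
  step_drift := h.step_drift hηle
  step_smooth := h.step_smooth hηle
  s_sq_le := h.initFloor_sq_le

lemma five_mul_sq_le (h : InitScale d N σ₁ σd ε ρ) :
    5 * (d * σ₁ ^ 2) ≤ (d * σd / ε ^ 2) ^ 2 * σd ^ 2 := by
  have hε := h.ε_pos
  have hd := h.d_pos
  have hσ₁ := h.σ₁_pos
  have hscale := h.ε_sq_mul_σ₁_le 0 0 0
  have hsq : (5 * (ε ^ 2 * σ₁)) ^ 2 ≤ (σd ^ 2) ^ 2 := by
    gcongr
    linarith [mul_pos (pow_pos hε 2) hσ₁]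
  calc 5 * (d * σ₁ ^ 2) ≤ (5 * (ε ^ 2 * σ₁)) ^ 2 * (d ^ 2 / ε ^ 4) := by
        rw [show (5 * (ε ^ 2 * σ₁)) ^ 2 * (d ^ 2 / ε ^ 4) = 25 * (d * (d * σ₁ ^ 2)) by
          field_simp
          norm_num]
        have := le_mul_of_one_le_left (mul_pos hd (pow_pos hσ₁ 2)).le h.one_le_d
        linarith [mul_pos hd (pow_pos hσ₁ 2)]
    _ ≤ (σd ^ 2) ^ 2 * (d ^ 2 / ε ^ 4) := by gcongr
    _ = (d * σd / ε ^ 2) ^ 2 * σd ^ 2 := by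
        field_simp

lemma exp_one_le (h : InitScale d N σ₁ σd ε ρ) : Real.exp 1 ≤ d * σd / ε ^ 2 := by
  have hε := pow_pos h.ε_pos 2
  have hscale := h.ε_sq_le 0 0 0
  rw [le_div_iff₀ hε]
  calc Real.exp 1 * ε ^ 2 ≤ 3 * ε ^ 2 := by
        gcongr
        exact Real.exp_one_lt_three.le
    _ ≤ σd := by linarith
    _ ≤ d * σd := le_mul_of_one_le_left h.σd_pos.le h.one_le_d

lemma sqrt_div_four_le (h : InitScale d N σ₁ σd ε ρ) :
    √σd / 4 ≤ d * σd / ε ^ 2 * initFloor d ε ρ := by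
  have hε := h.ε_pos
  have hd := h.d_pos
  have hρ := h.ρ_pos
  have hσd := h.σd_pos
  have hscale := h.ε_sq_le 1 0 2
  have hroot : ε * √d ≤ ρ * √σd := by
    refine le_of_sq_le_sq ?_ (by positivity)
    rw [mul_pow, mul_pow, Real.sq_sqrt hd.le, Real.sq_sqrt hσd.le]
    linarith [mul_pos (pow_pos hε 2) hd]
  calc √σd / 4 = √σd / (4 * (ε * √d)) * (ε * √d) := by field_simp
    _ ≤ √σd / (4 * (ε * √d)) * (ρ * √σd) := by gcongr
    _ = √σd ^ 2 * ρ / (4 * ε * √d) := by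
        field_simp
    _ = d * σd / ε ^ 2 * initFloor d ε ρ := by
        rw [Real.sq_sqrt hσd.le, initFloor]
        field_simp

end InitScale

end Scales

section Rates

lemma exp_mul_half_le_one_add_pow {x : ℝ} (hx : 0 ≤ x) (hx₁ : x ≤ 1) (t : ℕ) :
    Real.exp (t * (x / 2)) ≤ (1 + x) ^ t := by
  rw [Real.exp_nat_mul]
  refine pow_le_pow_left₀ (Real.exp_pos _).le ?_ t
  refine (Real.exp_bound_div_one_sub_of_interval (by linarith) (by linarith)).trans ?_
  rw [div_le_iff₀ (by linarith)]
  nlinarith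

lemma one_sub_pow_le_exp_neg_mul {x : ℝ} (hx : x ≤ 1) (t : ℕ) :
    (1 - x) ^ t ≤ Real.exp (-(t * x)) := by
  rw [← mul_neg, Real.exp_nat_mul]
  exact pow_le_pow_left₀ (by linarith) (Real.one_sub_le_exp_neg x) t

lemma exists_add_eq_of_lt_mul {x Λ D : ℝ} (hx : 0 < x) (hx₁ : x ≤ 1) (hΛ : 1 ≤ Λ) (hD : 0 ≤ D)
    {t : ℕ} (ht : 600 * (Λ + D) < t * x) :
    ∃ t₁ u : ℕ, t₁ + u = t ∧ 8 * Λ ≤ t₁ * x ∧ 256 * (2 * Λ + D) ≤ u * x := by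
  have hlower : 8 * Λ ≤ ⌈8 * Λ / x⌉₊ * x := (div_le_iff₀ hx).mp (Nat.le_ceil _)
  have hupper : ⌈8 * Λ / x⌉₊ * x ≤ 8 * Λ + 1 :=
    calc ⌈8 * Λ / x⌉₊ * x ≤ (8 * Λ / x + 1) * x := by
          gcongr
          exact (Nat.ceil_lt_add_one (by positivity)).le
      _ ≤ 8 * Λ + 1 := by
          rw [add_mul, div_mul_cancel₀ _ hx.ne']
          linarith
  have hle : ⌈8 * Λ / x⌉₊ ≤ t := by
    have hmul : (⌈8 * Λ / x⌉₊ : ℝ) * x ≤ t * x := by linarith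
    exact_mod_cast le_of_mul_le_mul_right hmul hx
  obtain ⟨u, rfl⟩ := Nat.exists_eq_add_of_le hle
  push_cast at ht
  exact ⟨_, u, rfl, hlower, by linarith⟩

/-- The number of iterations after which the loss is at most `δ`. -/
def convergenceTime (d : ℕ) (σd ε δ η : ℝ) : ℝ :=
  600 * (1 / (η * σd) * Real.log (d * σd / ε ^ 2)
    + 1 / (η * σd) * max 0 (Real.log (σd ^ 2 / δ)))

section ConvergenceTime

variable {d : ℕ} {σd ε δ η : ℝ}

lemma convergenceTime_le (hη : 0 ≤ η) (hσd : 0 ≤ σd) (hZ : 1 ≤ d * σd / ε ^ 2) :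
    convergenceTime d σd ε δ η ≤ 1200 * (1 / (η * σd) * Real.log (d * σd / ε ^ 2)
      + 1 / (η * σd) * max 0 (Real.log (σd ^ 2 / δ))) := by
  have hlog : 0 ≤ Real.log (d * σd / ε ^ 2) := Real.log_nonneg hZ
  rw [convergenceTime]
  gcongr
  norm_num

lemma convergenceTime_le_of_le_min (hd : 1 ≤ d) (hη : 0 ≤ η) (hσd : 0 < σd) (hε : 0 < ε)
    (hδ : 0 < δ) (hδσd : δ ≤ min σd (σd ^ 2)) :
    convergenceTime d σd ε δ η ≤ 1200 * (1 / (η * σd) * Real.log (d * σd / ε)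
      + 1 / (η * σd) * Real.log (σd / δ)) := by
  have hd₀ : (0 : ℝ) < d := by exact_mod_cast hd
  have hlog_d : 0 ≤ Real.log d := Real.log_natCast_nonneg d
  have hlog_δ : Real.log δ ≤ Real.log σd := Real.log_le_log hδ (hδσd.trans (min_le_left _ _))
  have hmax : max 0 (Real.log (σd ^ 2 / δ)) = Real.log (σd ^ 2 / δ) :=
    max_eq_right (Real.log_nonneg ((one_le_div hδ).mpr (hδσd.trans (min_le_right _ _))))
  have hlogs : Real.log (d * σd / ε ^ 2) + Real.log (σd ^ 2 / δ)
      ≤ 2 * (Real.log (d * σd / ε) + Real.log (σd / δ)) := by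
    rw [Real.log_div (by positivity) (by positivity), Real.log_div (by positivity) hδ.ne',
      Real.log_div (by positivity) hε.ne', Real.log_div hσd.ne' hδ.ne',
      Real.log_mul hd₀.ne' hσd.ne', Real.log_pow, Real.log_pow]
    push_cast
    linarith
  calc convergenceTime d σd ε δ η
      = 600 * (1 / (η * σd) * (Real.log (d * σd / ε ^ 2) + Real.log (σd ^ 2 / δ))) := by
        rw [convergenceTime, hmax, ← mul_add]
    _ ≤ 600 * (1 / (η * σd) * (2 * (Real.log (d * σd / ε) + Real.log (σd / δ)))) := by gcongr
    _ = _ := by ring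

end ConvergenceTime

lemma mul_inv_sq_mul_exp_neg_max_log_le {a δ Z c : ℝ} (ha : 0 < a) (hδ : 0 < δ) (hZ : 0 < Z)
    (hc : c ≤ Z ^ 2 * a) :
    c * Real.exp (-(2 * Real.log Z + max 0 (Real.log (a / δ)))) ≤ δ := by
  have hexp : a / δ ≤ Real.exp (max 0 (Real.log (a / δ))) :=
    (Real.log_le_iff_le_exp (by positivity)).mp (le_max_right _ _)
  have hsq : Real.exp (2 * Real.log Z) = Z ^ 2 := by
    rw [← Nat.cast_two, Real.exp_nat_mul, Real.exp_log hZ]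
  rw [Real.exp_neg, Real.exp_add, hsq, ← div_eq_mul_inv, div_le_iff₀ (by positivity)]
  calc c ≤ Z ^ 2 * a := hc
    _ = δ * (Z ^ 2 * (a / δ)) := by field_simp
    _ ≤ δ * (Z ^ 2 * Real.exp (max 0 (Real.log (a / δ)))) := by gcongr

end Rates

section Main

variable {m n d : ℕ} {S : Matrix (Fin m) (Fin n) ℝ} {Φ : Matrix (Fin m) (Fin d) ℝ}
  {Ψ : Matrix (Fin n) (Fin d) ℝ} {σ : Fin d → ℝ} {σ₁ σd ε ρ δ η : ℝ}

lemma loss_gdIter_le_of_convergenceTime_lt {N : ℝ} {W : Factors m n d}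
    (h : IsThinSVD S Φ Ψ σ σ₁ σd) (hs : InitScale d N σ₁ σd ε ρ) (hη : 0 < η)
    (hηle : η * (d * σ₁ ^ 3) ≤ 1 / 2 * (σd * ε ^ 2))
    (hr : ‖W.1‖ ^ 2 + ‖W.2‖ ^ 2 ≤ 2 * (N * d * ε ^ 2) / ρ)
    (hA : BoundedBelow (halfSum Φ Ψ W) (initFloor d ε ρ)) (hδ : 0 < δ) {t : ℕ}
    (ht : convergenceTime d σd ε δ η < t) :
    loss S (gdIter S η W t).1 (gdIter S η W t).2 ≤ δ := by
  have hp := hs.smallParams hη hηle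
  have hσd := hs.σd_pos
  have hx := hp.step_mul_σd
  set Z := d * σd / ε ^ 2
  have hZ : 0 < Z := (Real.exp_pos 1).trans_le hs.exp_one_le
  have hΛ : 1 ≤ Real.log Z := (Real.le_log_iff_exp_le hZ).mpr hs.exp_one_le
  have htime : 600 * (Real.log Z + max 0 (Real.log (σd ^ 2 / δ))) < t * (η * σd) := by
    rwa [convergenceTime, ← mul_add, one_div_mul_eq_div, mul_div_assoc',
      div_lt_iff₀ (by positivity)] at ht
  obtain ⟨t₁, u, rfl, ht₁, hu⟩ := exists_add_eq_of_lt_mul (mul_pos hη hσd) (by linarith) hΛ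
    (le_max_left _ _) htime
  have hgrown : √σd / 4 ≤ (1 + η * σd / 4) ^ t₁ * initFloor d ε ρ := by
    refine hs.sqrt_div_four_le.trans (mul_le_mul_of_nonneg_right ?_ hs.initFloor_pos.le)
    calc Z = Real.exp (Real.log Z) := (Real.exp_log hZ).symm
      _ ≤ Real.exp (t₁ * (η * σd / 4 / 2)) := Real.exp_le_exp.mpr (by linarith)
      _ ≤ (1 + η * σd / 4) ^ t₁ :=
          exp_mul_half_le_one_add_pow (by positivity) (by linarith) t₁
  have hdecay : (1 - η * σd / 256) ^ u
      ≤ Real.exp (-(2 * Real.log Z + max 0 (Real.log (σd ^ 2 / δ)))) :=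
    (one_sub_pow_le_exp_neg_mul (by linarith) u).trans (Real.exp_le_exp.mpr (by linarith))
  refine (loss_gdIter_le h hp (hr.trans_eq hs.initRadius_sq.symm) hA hgrown u).trans ?_
  exact (mul_le_mul_of_nonneg_left hdecay (by positivity)).trans
    (mul_inv_sq_mul_exp_neg_max_log_le (by positivity) hδ hZ hs.five_mul_sq_le)

lemma InitScale.of_rank_eq (hd : 0 < d) (hS : S.rank = d) (h : IsThinSVD S Φ Ψ σ σ₁ σd)
    (hρ : 0 < ρ) (hρ₁ : ρ ≤ 1) (hε : 0 < ε)
    (hεle : ε ≤ ρ ^ 2 / 1000 * (σd / (√((d : ℝ) ^ 3 * σ₁) * ((m : ℝ) + n)))) :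
    InitScale d ((m : ℝ) + n) σ₁ σd ε ρ := by
  have hσd := h.pos
  have hσ : σd ≤ σ₁ := (h.lower ⟨0, hd⟩).trans (h.upper ⟨0, hd⟩)
  have hσ₁ : 0 < σ₁ := hσd.trans_le hσ
  have hdm : (d : ℝ) ≤ m := by exact_mod_cast hS ▸ S.rank_le_height
  have hd₁ : (1 : ℝ) ≤ d := by exact_mod_cast hd
  have hdN : (d : ℝ) ≤ m + n := hdm.trans (le_add_of_nonneg_right n.cast_nonneg)
  have hN : 0 < (m : ℝ) + n := by linarith
  refine ⟨hρ, hρ₁, hd₁, hdN, hσd, hσ, hε, ?_⟩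
  rw [← mul_div_assoc, le_div_iff₀ (by positivity)] at hεle
  have hsq := pow_le_pow_left₀ (by positivity) hεle 2
  simp only [mul_pow, div_pow, Real.sq_sqrt (show (0 : ℝ) ≤ (d : ℝ) ^ 3 * σ₁ by positivity)] at hsq
  linarith

theorem le_gaussianInit_loss_gdIter_le (h : IsThinSVD S Φ Ψ σ σ₁ σd)
    (hs : InitScale d ((m : ℝ) + n) σ₁ σd ε ρ) (hη : 0 < η)
    (hηle : η * (d * σ₁ ^ 3) ≤ 1 / 2 * (σd * ε ^ 2)) (hδ : 0 < δ) :
    ENNReal.ofReal (1 - ρ) ≤ gaussianInit m n d ε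
      {W | ∀ t : ℕ, convergenceTime d σd ε δ η < t →
        loss S (gdIter S η (Matrix.of W.1, Matrix.of W.2) t).1
          (gdIter S η (Matrix.of W.1, Matrix.of W.2) t).2 ≤ δ} := by
  have hρ := hs.ρ_pos
  have hε := hs.ε_pos
  have hd := hs.d_pos
  have hN := hs.N_pos
  have hgood := le_gaussianInit_norm_sq_le_and_boundedBelow h.ortho_left Ψ hε
    (R := 2 * (((m : ℝ) + n) * d * ε ^ 2) / ρ) (τ := ρ * ε / (4 * d)) (by positivity)
    (by positivity)
  have hfail : ((m : ℝ) + n) * d * ε ^ 2 / (2 * (((m : ℝ) + n) * d * ε ^ 2) / ρ)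
      + d * (2 * (ρ * ε / (4 * d)) / ε) = ρ := by
    field_simp
    norm_num
  rw [hfail] at hgood
  exact hgood.trans (measure_mono fun W ⟨hr, hA⟩ t ht =>
    loss_gdIter_le_of_convergenceTime_lt h hs hη hηle hr hA hδ ht)

end Main

end MatFac

end

theorem theorem1_general {ρ : ℝ} (hρ : 0 < ρ) (hρ₁ : ρ ≤ 1) {m n d : ℕ}
    (S : Matrix (Fin m) (Fin n) ℝ) (hd : 0 < d) (hS : S.rank = d) {σ₁ σd : ℝ}
    (hσ₁ : σ₁ = MatFac.sval S 0) (hσd : σd = MatFac.sval S (d - 1)) {ε : ℝ} (hε : 0 < ε)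
    (hεle : ε ≤ ρ ^ 2 / 1000 * (σd / (√((d : ℝ) ^ 3 * σ₁) * ((m : ℝ) + n)))) {δ η : ℝ}
    (hδ : 0 < δ) (hη : 0 < η) (hηle : η ≤ 1 / 2 * (σd * ε ^ 2 / ((d : ℝ) * σ₁ ^ 3))) :
    MatFac.convergenceTime d σd ε δ η ≤ 1200 * (1 / (η * σd) * Real.log (d * σd / ε ^ 2)
        + 1 / (η * σd) * max 0 (Real.log (σd ^ 2 / δ))) ∧
      (δ ≤ min σd (σd ^ 2) →
        MatFac.convergenceTime d σd ε δ η ≤ 1200 * (1 / (η * σd) * Real.log (d * σd / ε)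
          + 1 / (η * σd) * Real.log (σd / δ))) ∧
      ENNReal.ofReal (1 - ρ) ≤
        MatFac.gaussianInit m n d ε
          {W | ∀ t : ℕ, MatFac.convergenceTime d σd ε δ η < t →
            MatFac.loss S
              (MatFac.gdIter S η (Matrix.of W.1, Matrix.of W.2) t).1
              (MatFac.gdIter S η (Matrix.of W.1, Matrix.of W.2) t).2 ≤ δ} := by
  obtain ⟨Φ, Ψ, σ, hsvd⟩ := MatFac.exists_isThinSVD S hd hS
  rw [← hσ₁, ← hσd] at hsvd
  have hs := MatFac.InitScale.of_rank_eq hd hS hsvd hρ hρ₁ hε hεle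
  have hstep : η * (d * σ₁ ^ 3) ≤ 1 / 2 * (σd * ε ^ 2) := by
    have := mul_pos hs.d_pos (pow_pos hs.σ₁_pos 3)
    rwa [mul_div_assoc', le_div_iff₀ this] at hηle
  refine ⟨MatFac.convergenceTime_le hη.le hs.σd_pos.le ?_,
    MatFac.convergenceTime_le_of_le_min hd hη.le hs.σd_pos hε hδ,
    MatFac.le_gaussianInit_loss_gdIter_le hsvd hs hη hstep hδ⟩
  exact (Real.one_le_exp zero_le_one).trans hs.exp_one_le

theorem theorem1 :
    ∃ (k : ℕ) (C : ℝ), 0 < C ∧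
    ∀ ρ : ℝ, 0 < ρ → ρ < 1 →
    ∃ (c₁ c₂ : ℝ), 0 < c₁ ∧ 0 < c₂ ∧
    ∀ (m n d : ℕ) (S : Matrix (Fin m) (Fin n) ℝ), 0 < d → S.rank = d →
    ∀ σ₁ σd : ℝ, σ₁ = MatFac.sval S 0 → σd = MatFac.sval S (d - 1) →
    ∀ ε : ℝ, 0 < ε →
      ε ≤ c₁ * (σd / (Real.sqrt ((d : ℝ) ^ 3 * σ₁) * ((m : ℝ) + n))) /
        Real.log (((m : ℝ) + n) * (σ₁ / σd)) ^ k →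
    ∃ T : ℝ → ℝ → ℝ, ∀ δ η : ℝ, 0 < δ → 0 < η →
      η ≤ c₂ * (σd * ε ^ 2 / ((d : ℝ) * σ₁ ^ 3)) →
      T δ η ≤ C * (1 / (η * σd) * Real.log ((d : ℝ) * σd / ε ^ 2)
          + 1 / (η * σd) * max 0 (Real.log (σd ^ 2 / δ))) ∧
      (δ ≤ min σd (σd ^ 2) →
        T δ η ≤ C * (1 / (η * σd) * Real.log ((d : ℝ) * σd / ε)
          + 1 / (η * σd) * Real.log (σd / δ))) ∧
      ENNReal.ofReal (1 - ρ) ≤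
        MatFac.gaussianInit m n d ε
          {W | ∀ t : ℕ, T δ η < (t : ℝ) →
            MatFac.loss S
              (MatFac.gdIter S η (Matrix.of W.1, Matrix.of W.2) t).1
              (MatFac.gdIter S η (Matrix.of W.1, Matrix.of W.2) t).2 ≤ δ} := by
  refine ⟨0, 1200, by norm_num, fun ρ hρ hρ₁ => ⟨ρ ^ 2 / 1000, 1 / 2, by positivity, by norm_num,
    fun m n d S hd hS σ₁ σd hσ₁ hσd ε hε hεle => ⟨MatFac.convergenceTime d σd ε, fun δ η => ?_⟩⟩⟩
  rw [pow_zero, div_one] at hεle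
  exact theorem1_general hρ hρ₁.le S hd hS hσ₁ hσd hε hεle
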